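/- \textbf{Setting.} A network $N$ consists of a finite set of vertices, a finite set $E(N)$ of arcs (each arc $e$ leading from a vertex to a vertex), a finite real capacity $c(e)\ge 0$ for each arc, and two distinct vertices $s$ (source) and $t$ (sink). A flow is a function $f:E(N)\to\mathbb R$ with $0\le f(e)\le c(e)$ for every arc $e$ that is conserved at every vertex other than $s,t$. An augmenting path for $f$ is a path from $s$ to $t$ without repeated vertices that traverses arcs forwards or backwards, such that the residual capacity ($c(e)-f(e)$ if $e$ is traversed forwards, $f(e)$ if backwards) is positive at each of its steps. A run of the Ford--Fulkerson algorithm on $N$ starts with an arbitrary flow $f_0$. For every ordinal $\beta$, if there is an augmenting path for $f_\beta$, an adversary chooses one, and $f_{\beta+1}$ arises from $f_\beta$ by pushing as much as possible (the minimum residual capacity) along it; otherwise $f_{\beta+1}=f_\beta$. For a limit ordinal $\alpha$, $$f_\alpha(e)=f_0(e)+\sum_{\beta<\alpha}\delta_\beta(e),$$ where $\delta_\beta(e)$ is the change of the flow on $e$ in the step from $\beta$ to $\beta+1$. The run terminates if $f_\alpha=f_{\alpha+1}$ for some $\alpha$, and its run-time is the least such $\alpha$. For $m\in\mathbb N$ let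 $W(m)$ be the supremum of the run-times of all runs on all networks with exactly $m$ arcs. \textbf{Theorem.} The worst-case running time of the Ford--Fulkerson algorithm is $\omega^{\Theta(|E(N)|)}$. Precisely: (i) For every network $N$ and every run on $N$, the run is well defined (for every limit ordinal $\alpha$ and every arc $e$ the sum above converges absolutely and $f_\alpha(e)=\lim_{\beta\to\alpha}f_\beta(e)$, and $f_\alpha$ is a flow for every ordinal $\alpha$), it terminates, and its run-time is at most $\omega^{|E(N)|}$. (ii) For every integer $\ell\ge 1$ there are a network with exactly $\ell$ arcs, without loops and parallel arcs, and a run on it with run-time at least $\omega^{\lfloor \ell/25\rfloor}$. (iii) There are functions $g,h:\mathbb N\to\mathbb N$ with $g(m)=\Theta(m)$ and $h(m)=\Theta(m)$ such that for every $m\ge 1$ the run-times of runs on networks with $m$ arcs are bounded and $\omega^{g(m)}\le W(m)\le\omega^{h(m)}$. -/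

import Mathlib

open Filter Topology Asymptotics
open scoped Ordinal

namespace FordFulkerson

/-- A network with vertex set `V` and arc set `E`: every arc `e` goes from `src e` to `tgt e` and
has a finite capacity `cap e ≥ 0`. Parallel arcs and loops are allowed. -/
structure Network (V E : Type*) where
  src : E → V
  tgt : E → V
  cap : E → ℝ
  cap_nonneg : ∀ e, 0 ≤ cap e
  s : V
  t : V
  s_ne_t : s ≠ t

namespace Network

variable {V E : Type*} (N : Network V E)

/-- No loops and no parallel arcs, i.e. the arc set is a set of ordered pairs of distinct
vertices. -/
def IsSimple : Prop :=
  (∀ e, N.src e ≠ N.tgt e) ∧ ∀ e e', N.src e = N.src e' → N.tgt e = N.tgt e' → e = e'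

open Classical in
/-- `f` is a (not necessarily maximum) flow: it obeys the capacities and is conserved at every
vertex other than the source and the sink. -/
def IsFlow [Fintype E] (f : E → ℝ) : Prop :=
  (∀ e, 0 ≤ f e ∧ f e ≤ N.cap e) ∧
    ∀ u, u ≠ N.s → u ≠ N.t →
      ∑ e with N.tgt e = u, f e = ∑ e with N.src e = u, f e

/-- Initial vertex of a step of a residual path: `(e, true)` traverses `e` forwards, `(e, false)`
traverses `e` backwards. -/
def stepSrc (d : E × Bool) : V := if d.2 then N.src d.1 else N.tgt d.1

/-- Final vertex of a step. -/
def stepTgt (d : E × Bool) : V := if d.2 then N.tgt d.1 else N.src d.1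

/-- Residual capacity of a step: `cap e - f e` forwards, `f e` backwards. -/
def residualCap (f : E → ℝ) (d : E × Bool) : ℝ := if d.2 then N.cap d.1 - f d.1 else f d.1

/-- `N.IsWalk u v p`: the list of steps `p` leads from `u` to `v`. -/
def IsWalk : V → V → List (E × Bool) → Prop
  | u, v, [] => u = v
  | u, v, d :: p => N.stepSrc d = u ∧ IsWalk (N.stepTgt d) v p

/-- `p` is an augmenting path for `f`: it leads from `s` to `t`, visits no vertex twice, and all
its steps have positive residual capacity. -/
def IsAugmenting (f : E → ℝ) (p : List (E × Bool)) : Prop :=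
  N.IsWalk N.s N.t p ∧ (N.s :: p.map N.stepTgt).Nodup ∧ ∀ d ∈ p, 0 < N.residualCap f d

/-- The largest amount that can be pushed along `p`: the minimum residual capacity of its steps. -/
noncomputable def bottleneck (f : E → ℝ) (p : List (E × Bool)) : ℝ :=
  sInf (N.residualCap f '' {d | d ∈ p})

open Classical in
/-- `1` if `e` is a forward arc of `p`, `-1` if it is a backward arc of `p`, and `0` otherwise. -/
noncomputable def sign (p : List (E × Bool)) (e : E) : ℝ :=
  if (e, true) ∈ p then 1 else if (e, false) ∈ p then -1 else 0

/-- A run of the transfinite algorithm: an arbitrary initial flow, together with the choices of the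
adversary, who picks an augmenting path for the current flow whenever there is one. As a run is a
single sequence, choices that depend on the stage `β` and the current flow produce all runs, also
those of an adversary that looks at the whole history. -/
structure Run [Fintype E] where
  init : E → ℝ
  init_isFlow : N.IsFlow init
  choice : Ordinal.{0} → (E → ℝ) → List (E × Bool)
  choice_spec : ∀ β f, (∃ p, N.IsAugmenting f p) → N.IsAugmenting f (choice β f)

namespace Run

variable {N} [Fintype E] (r : N.Run)

open Classical in
/-- The change of the flow on `e` in the step from stage `β` to stage `β + 1` if the flow at stage
`β` is `f`: as much as possible is pushed along the chosen path; nothing happens if there is no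
augmenting path. -/
noncomputable def increment (β : Ordinal.{0}) (f : E → ℝ) (e : E) : ℝ :=
  if ∃ p, N.IsAugmenting f p then sign (r.choice β f) e * N.bottleneck f (r.choice β f) else 0

/-- The flow after `α` steps. At a limit ordinal it is the initial flow plus the sum of the changes
made in all earlier steps. -/
noncomputable def flow (α : Ordinal.{0}) : E → ℝ :=
  Ordinal.limitRecOn (motive := fun _ => E → ℝ) α r.init
    (fun β f e => f e + r.increment β f e)
    (fun α _ f e => r.init e + ∑' β : Set.Iio α, r.increment β.1 (f β.1 β.2) e)

theorem flow_zero : r.flow 0 = r.init :=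
  Ordinal.limitRecOn_zero ..

theorem flow_add_one (β : Ordinal.{0}) :
    r.flow (β + 1) = fun e => r.flow β e + r.increment β (r.flow β) e :=
  Ordinal.limitRecOn_add_one ..

theorem flow_limit {α : Ordinal.{0}} (hα : Order.IsSuccLimit α) :
    r.flow α = fun e => r.init e + ∑' β : Set.Iio α, r.increment β.1 (r.flow β.1) e :=
  Ordinal.limitRecOn_limit _ _ _ _ hα

/-- The run comes to a halt. -/
def Terminates : Prop := ∃ α, r.flow α = r.flow (α + 1)

/-- The run-time: the least `α` with `f_α = f_{α+1}` (meaningful for runs that terminate). -/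
noncomputable def runTime : Ordinal.{0} := sInf {α | r.flow α = r.flow (α + 1)}

end Run

end Network

/-- All run-times of runs on networks with exactly `m` arcs. -/
def runTimes (m : ℕ) : Set Ordinal.{0} :=
  {α | ∃ (V E : Type) (_ : Fintype V) (_ : Fintype E) (N : Network V E) (r : N.Run),
    Fintype.card E = m ∧ α = r.runTime}

/-- The worst-case running time on networks with `m` arcs. -/
noncomputable def worstCase (m : ℕ) : Ordinal.{0} := sSup (runTimes m)

end FordFulkerson

namespace FordFulkerson

namespace Network

variable {V E : Type*} (N : Network V E)

/-! ### One augmentation: conservation, saturation, bounds -/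

section Augment

variable {N}

/-! Well-definedness: every step raises the net flow into `t` by the amount pushed, and that net
flow is bounded by the total capacity. Hence the amounts are summable, they dominate the changes on
each arc, and flows converge at limit stages to flows; moreover the amounts tend to zero there.

Upper bound (`not_limitedTo`): if all bottlenecks lie in a set of `k` arcs, fewer than `ω ^ k`
consecutive steps are possible. An arc with positive residual capacity in both directions at a limit
stage is eventually not a bottleneck, as the amounts tend to zero; so it can be dropped from the set
and induction applies. If every arc is empty or full at the limit, then close to it each arc of
positive capacity can be a bottleneck in only one direction. The same dichotomy at an earlier stage,
`ω ^ k` steps on, again either frees an arc or leaves all these arcs saturated in their only usable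
direction, so that no further step has a bottleneck.

Lower bound: in a chain of bridges an augmenting path may cross each crossbar backwards, forwards or
not at all. The flows on the crossbars thus act as counters: one step subtracts `b` from some
counters and adds it to others, where `b` is the minimum of the former (`exists_move`). With `ρ ^ 2
= 1 - ρ`, three counters evolve as `(c, ρ c, 0) → (ρ² c, 0, ρ c) → (0, ρ² c, ρ³ c) → (ρ³ c, ρ⁴ c,
0)`, a scaled copy of the start, so they can be drained in `ω` rounds. The first two moves of a
round also load `ρ c` and `ρ² c` into the level below, which is then emptied before the next round.
Each level of three bridges, that is 15 arcs, therefore multiplies the length by `ω` (`canEmpty`).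
-/

theorem residualCap_nonneg [Fintype E] {f : E → ℝ} (hf : N.IsFlow f) (d : E × Bool) :
    0 ≤ N.residualCap f d := by
  unfold residualCap
  split
  · exact sub_nonneg.2 (hf.1 _).2
  · exact (hf.1 _).1

theorem residualCap_add_residualCap_not (f : E → ℝ) (e : E) (b : Bool) :
    N.residualCap f (e, b) + N.residualCap f (e, !b) = N.cap e := by
  cases b <;> simp [residualCap]

theorem IsAugmenting.ne_nil {f : E → ℝ} {p : List (E × Bool)} (hp : N.IsAugmenting f p) :
    p ≠ [] := by
  rintro rfl
  exact N.s_ne_t hp.1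

/-- The bottleneck of a nonempty path is attained. -/
theorem isLeast_bottleneck (f : E → ℝ) {p : List (E × Bool)} (hp : p ≠ []) :
    IsLeast (N.residualCap f '' {d | d ∈ p}) (N.bottleneck f p) := by
  have hfin : (N.residualCap f '' {d | d ∈ p}).Finite := (List.finite_toSet p).image _
  have hne : (N.residualCap f '' {d | d ∈ p}).Nonempty := by
    obtain ⟨d, hd⟩ := List.exists_mem_of_ne_nil p hp
    exact ⟨_, d, hd, rfl⟩
  exact ⟨hne.csInf_mem hfin, fun x hx => csInf_le hfin.bddBelow hx⟩

theorem IsAugmenting.bottleneck_pos {f : E → ℝ} {p : List (E × Bool)}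
    (hp : N.IsAugmenting f p) : 0 < N.bottleneck f p := by
  obtain ⟨d, hd, h⟩ := (isLeast_bottleneck (N := N) f hp.ne_nil).1
  rw [← h]
  exact hp.2.2 d hd

theorem bottleneck_le (f : E → ℝ) {p : List (E × Bool)} {d : E × Bool} (hd : d ∈ p) :
    N.bottleneck f p ≤ N.residualCap f d :=
  (isLeast_bottleneck (N := N) f (List.ne_nil_of_mem hd)).2 ⟨d, hd, rfl⟩

/-- A path without repeated vertices does not traverse an arc in both directions. -/
theorem IsWalk.not_mem_both {u v : V} {p : List (E × Bool)} (h : N.IsWalk u v p)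
    (hn : (u :: p.map N.stepTgt).Nodup) {e : E} (h1 : (e, true) ∈ p) (h2 : (e, false) ∈ p) :
    False := by
  induction p generalizing u with
  | nil => simp at h1
  | cons a p ih =>
    obtain ⟨ha, hw⟩ := h
    rw [List.map_cons, List.nodup_cons] at hn
    have key : ∀ d ∈ p, N.stepTgt d ≠ u := by
      rintro d hd rfl
      exact hn.1 (List.mem_cons_of_mem _ (List.mem_map_of_mem hd))
    rcases List.mem_cons.1 h1 with rfl | h1 <;> rcases List.mem_cons.1 h2 with h2 | h2
    · simp at h2
    · exact key _ h2 (by simpa [stepSrc, stepTgt] using ha)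
    · subst h2
      exact key _ (by simpa using h1) (by simpa [stepSrc, stepTgt] using ha)
    · exact ih hw hn.2 h1 h2

theorem sign_true {p : List (E × Bool)} {e : E} (h : (e, true) ∈ p) : sign p e = 1 := by
  simp [sign, h]

theorem sign_false {p : List (E × Bool)} {e : E} (h : (e, true) ∉ p) (h' : (e, false) ∈ p) :
    sign p e = -1 := by
  simp [sign, h, h']

theorem abs_sign_le (p : List (E × Bool)) (e : E) : |sign p e| ≤ 1 := by
  unfold sign
  split_ifs <;> simp

open Classical in
/-- The net flow into `u`. -/
noncomputable def excess [Fintype E] (N : Network V E) (f : E → ℝ) (u : V) : ℝ :=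
  ∑ e, f e * ((if N.tgt e = u then 1 else 0) - (if N.src e = u then 1 else 0))

theorem excess_eq_zero_iff [Fintype E] (f : E → ℝ) (u : V) [DecidablePred fun e => N.tgt e = u]
    [DecidablePred fun e => N.src e = u] :
    N.excess f u = 0 ↔ ∑ e with N.tgt e = u, f e = ∑ e with N.src e = u, f e := by
  unfold excess
  rw [Finset.sum_filter, Finset.sum_filter, ← sub_eq_zero (b := Finset.sum _ _),
    ← Finset.sum_sub_distrib]
  refine Eq.congr (Finset.sum_congr rfl fun e _ => ?_) rfl
  by_cases h1 : N.tgt e = u <;> by_cases h2 : N.src e = u <;> simp [h1, h2]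

theorem excess_add_mul [Fintype E] (f g : E → ℝ) (b : ℝ) (u : V) :
    N.excess (fun e => f e + g e * b) u = N.excess f u + N.excess g u * b := by
  unfold excess
  rw [Finset.sum_mul, ← Finset.sum_add_distrib]
  exact Finset.sum_congr rfl fun e _ => by ring

open Classical in
theorem excess_sign [Fintype E] {u v : V} {p : List (E × Bool)} (h : N.IsWalk u v p)
    (hn : (u :: p.map N.stepTgt).Nodup) (x : V) :
    N.excess (sign p) x = (if v = x then 1 else 0) - (if u = x then 1 else 0) := by
  induction p generalizing u with
  | nil =>
    cases (show u = v from h)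
    simp [excess, sign]
  | cons d p ih =>
    -- The arc of the first step does not recur, so the signs of the path are those of its tail plus
    -- one contribution.
    have hnot : ∀ c, (d.1, c) ∉ p := by
      intro c hc
      have hboth := h.not_mem_both hn (e := d.1)
      have hnd : d ∉ p := by
        intro hd
        rw [List.map_cons] at hn
        exact (List.nodup_cons.1 (List.nodup_cons.1 hn).2).1 (List.mem_map_of_mem hd)
      obtain ⟨e, b⟩ := d
      cases b <;> cases c <;> simp_all
    have h1 : sign (d :: p) = fun e => sign p e + (if e = d.1 then
        (if d.2 then (1 : ℝ) else -1) else 0) * 1 := by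
      funext e
      obtain ⟨e', b⟩ := d
      by_cases he : e = e'
      · subst he
        have := hnot true
        have := hnot false
        cases b <;> simp_all [sign]
      · simp [sign, he]
    obtain ⟨ha, hw⟩ := h
    rw [List.map_cons] at hn
    rw [h1, excess_add_mul, ih hw (List.nodup_cons.1 hn).2, ← ha]
    have h2 : N.excess (fun e => if e = d.1 then (if d.2 then (1 : ℝ) else -1) else 0) x =
        (if N.stepTgt d = x then 1 else 0) - (if N.stepSrc d = x then 1 else 0) := by
      unfold excess
      rw [Finset.sum_eq_single d.1 (by intro e _ he; simp [he]) (by simp)]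
      obtain ⟨e, b⟩ := d
      cases b <;> simp [stepTgt, stepSrc]
    rw [h2]
    ring

theorem IsAugmenting.isFlow [Fintype E] {f : E → ℝ} (hf : N.IsFlow f) {p : List (E × Bool)}
    (hp : N.IsAugmenting f p) : N.IsFlow fun e => f e + sign p e * N.bottleneck f p := by
  classical
  have hb := hp.bottleneck_pos
  refine ⟨fun e => ?_, fun u hs ht => ?_⟩
  · beta_reduce
    by_cases h1 : (e, true) ∈ p
    · have := bottleneck_le (N := N) f h1
      simp only [residualCap, if_true] at this
      rw [sign_true h1]
      constructor <;> linarith [(hf.1 e).1]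
    · by_cases h2 : (e, false) ∈ p
      · have := bottleneck_le (N := N) f h2
        simp only [residualCap, Bool.false_eq_true, if_false] at this
        rw [sign_false h1 h2]
        constructor <;> linarith [(hf.1 e).2]
      · simpa [sign, h1, h2] using hf.1 e
  · have h0 := (excess_eq_zero_iff (N := N) f u).2 (by convert hf.2 u hs ht)
    have := (excess_eq_zero_iff (N := N) (fun e => f e + sign p e * N.bottleneck f p) u).1 (by
      rw [excess_add_mul, excess_sign hp.1 hp.2.1, h0]
      simp [hs.symm, ht.symm])
    convert this

/-- Lets feasibility pass to limit stages. -/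
theorem isClosed_setOf_isFlow [Fintype E] : IsClosed {f | N.IsFlow f} := by
  classical
  have : {f | N.IsFlow f} = (⋂ e, {f : E → ℝ | 0 ≤ f e}) ∩ (⋂ e, {f : E → ℝ | f e ≤ N.cap e}) ∩
      ⋂ u, ⋂ (_ : u ≠ N.s), ⋂ (_ : u ≠ N.t), {f | N.excess f u = 0} := by
    ext f
    simp only [IsFlow, forall_and, Set.mem_ofPred_eq, Set.mem_inter_iff, Set.mem_iInter]
    refine and_congr_right fun _ => forall_congr' fun u => forall_congr' fun _ =>
      forall_congr' fun _ => ?_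
    rw [excess_eq_zero_iff]
  rw [this]
  refine ((isClosed_iInter fun e => ?_).inter (isClosed_iInter fun e => ?_)).inter
    (isClosed_iInter fun u => isClosed_iInter fun _ => isClosed_iInter fun _ => ?_)
  · exact isClosed_le continuous_const (continuous_apply e)
  · exact isClosed_le (continuous_apply e) continuous_const
  · refine isClosed_eq ?_ continuous_const
    unfold excess
    fun_prop

theorem abs_excess_le [Fintype E] {f : E → ℝ} (hf : N.IsFlow f) (u : V) :
    |N.excess f u| ≤ ∑ e, N.cap e := by
  unfold excess
  refine (Finset.abs_sum_le_sum_abs _ _).trans (Finset.sum_le_sum fun e _ => ?_)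
  rw [abs_mul, abs_of_nonneg (hf.1 e).1]
  refine (mul_le_of_le_one_right (hf.1 e).1 ?_).trans (hf.1 e).2
  split_ifs <;> simp

end Augment

/-! ### Convergence of runs at limit stages -/

namespace Run

variable {N} [Fintype E] (r : N.Run)

open Classical in
/-- The amount pushed at stage `β`. -/
noncomputable def amount (β : Ordinal.{0}) : ℝ :=
  if ∃ p, N.IsAugmenting (r.flow β) p then N.bottleneck (r.flow β) (r.choice β (r.flow β)) else 0

theorem amount_nonneg (β : Ordinal.{0}) : 0 ≤ r.amount β := by
  unfold amount
  split_ifs with h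
  · exact (r.choice_spec β _ h).bottleneck_pos.le
  · exact le_rfl

theorem amount_pos {β : Ordinal.{0}} (h : ∃ p, N.IsAugmenting (r.flow β) p) : 0 < r.amount β := by
  rw [amount, if_pos h]
  exact (r.choice_spec β _ h).bottleneck_pos

theorem increment_eq (β : Ordinal.{0}) (e : E) :
    r.increment β (r.flow β) e = sign (r.choice β (r.flow β)) e * r.amount β := by
  unfold increment amount
  split_ifs <;> simp

theorem abs_increment_le (β : Ordinal.{0}) (e : E) :
    |r.increment β (r.flow β) e| ≤ r.amount β := by
  rw [increment_eq, abs_mul, abs_of_nonneg (r.amount_nonneg β)]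
  exact mul_le_of_le_one_left (r.amount_nonneg β) (abs_sign_le _ _)

theorem excess_increment (β : Ordinal.{0}) :
    N.excess (r.increment β (r.flow β)) N.t = r.amount β := by
  by_cases h : ∃ p, N.IsAugmenting (r.flow β) p
  · have hp := r.choice_spec β _ h
    have h1 : r.increment β (r.flow β) =
        fun e => 0 + sign (r.choice β (r.flow β)) e * r.amount β := by
      funext e
      rw [increment_eq, zero_add]
    rw [h1, excess_add_mul, excess_sign hp.1 hp.2.1]
    simp [excess, N.s_ne_t]
  · have h1 : r.increment β (r.flow β) = 0 := by
      funext e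
      simp [increment, h]
    rw [h1, amount, if_neg h]
    simp [excess]

theorem isFlow_succ {β : Ordinal.{0}} (h : N.IsFlow (r.flow β)) : N.IsFlow (r.flow (β + 1)) := by
  rw [flow_add_one]
  unfold increment
  split_ifs with hp
  · exact (r.choice_spec β _ hp).isFlow h
  · simpa using h

/-- The flow at stage `α` is feasible and is the initial flow plus the sum of all changes. -/
def WellDefinedAt (α : Ordinal.{0}) : Prop :=
  N.IsFlow (r.flow α) ∧ ∀ e, HasSum
    ((Set.Iio α).indicator fun β => r.increment β (r.flow β) e) (r.flow α e - r.init e)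

variable {r}

/-- `excess` is linear in the flow, so the convergent sums of changes on the arcs combine to the sum
of the amounts, which is the gain in net flow into `t`. -/
theorem WellDefinedAt.hasSum_amount {α : Ordinal.{0}} (h : r.WellDefinedAt α) :
    HasSum ((Set.Iio α).indicator r.amount) (N.excess (r.flow α) N.t - N.excess r.init N.t) := by
  classical
  have h1 := hasSum_sum (s := Finset.univ) fun e _ => (h.2 e).mul_right
    (((if N.tgt e = N.t then 1 else 0) - (if N.src e = N.t then 1 else 0) : ℝ))
  have h2 : (Set.Iio α).indicator r.amount = fun β => ∑ e,
      (Set.Iio α).indicator (fun β => r.increment β (r.flow β) e) β *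
        ((if N.tgt e = N.t then 1 else 0) - (if N.src e = N.t then 1 else 0)) := by
    funext β
    by_cases hβ : β ∈ Set.Iio α
    · simp only [Set.indicator_of_mem hβ, ← r.excess_increment, excess]
    · simp [Set.indicator_of_notMem hβ]
  have h3 : N.excess (r.flow α) N.t - N.excess r.init N.t = ∑ e, (r.flow α e - r.init e) *
      ((if N.tgt e = N.t then 1 else 0) - (if N.src e = N.t then 1 else 0)) := by
    simp [excess, sub_mul]
  rw [h2, h3]
  exact h1

theorem WellDefinedAt.succ {α : Ordinal.{0}} (h : r.WellDefinedAt α) :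
    r.WellDefinedAt (α + 1) := by
  classical
  refine ⟨r.isFlow_succ h.1, fun e => ?_⟩
  have h1 : HasSum (Set.indicator {α} fun β => r.increment β (r.flow β) e)
      (r.increment α (r.flow α) e) := by
    convert hasSum_single (f := Set.indicator {α} fun β => r.increment β (r.flow β) e) α ?_ using 1
    · simp
    · intro β hβ
      simp [hβ]
  convert (h.2 e).add h1 using 1
  · rw [← Set.indicator_union_of_disjoint (by simp)]
    congr 1
    ext β
    simp [le_iff_lt_or_eq]
  · rw [flow_add_one]
    ring

theorem exists_lt_forall_mem_lt {α : Ordinal.{0}} (hα : Order.IsSuccLimit α)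
    (u : Finset Ordinal.{0}) : ∃ β < α, ∀ x ∈ u, x < α → x < β := by
  classical
  induction u using Finset.induction_on with
  | empty => exact ⟨0, hα.bot_lt, by simp⟩
  | insert a u _ ih =>
    obtain ⟨β, hβ, h⟩ := ih
    by_cases ha : a < α
    · refine ⟨max β (a + 1), max_lt hβ (hα.add_one_lt ha), fun x hx hxα => ?_⟩
      rcases Finset.mem_insert.1 hx with rfl | hx
      · exact lt_max_of_lt_right (Order.lt_add_one_iff.2 le_rfl)
      · exact lt_max_of_lt_left (h x hx hxα)
    · refine ⟨β, hβ, fun x hx hxα => ?_⟩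
      rcases Finset.mem_insert.1 hx with rfl | hx
      · exact absurd hxα ha
      · exact h x hx hxα

/-- A finite set of stages below a limit lies below some earlier stage `β`. Its partial sum is
therefore at most the gain in net flow into `t` up to `β`, a difference of two numbers of absolute
value at most the total capacity. -/
theorem summable_amount_of_forall_lt {α : Ordinal.{0}} (hα : Order.IsSuccLimit α)
    (h : ∀ β < α, r.WellDefinedAt β) : Summable ((Set.Iio α).indicator r.amount) := by
  refine summable_of_sum_le (c := 2 * ∑ e, N.cap e)
    (fun β => Set.indicator_nonneg (fun β _ => r.amount_nonneg β) β) fun u => ?_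
  obtain ⟨β, hβ, hu⟩ := exists_lt_forall_mem_lt hα u
  have h1 : ∑ x ∈ u, (Set.Iio α).indicator r.amount x =
      ∑ x ∈ u, (Set.Iio β).indicator r.amount x := by
    refine Finset.sum_congr rfl fun x hx => ?_
    by_cases hxα : x < α
    · rw [Set.indicator_of_mem (Set.mem_Iio.2 hxα), Set.indicator_of_mem (Set.mem_Iio.2 (hu x hx hxα))]
    · rw [Set.indicator_of_notMem (by simpa using hxα),
        Set.indicator_of_notMem fun h => hxα (lt_trans (Set.mem_Iio.1 h) hβ)]
  rw [h1]
  refine (sum_le_hasSum u (fun x _ => Set.indicator_nonneg (fun β _ => r.amount_nonneg β) x)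
    (h β hβ).hasSum_amount).trans ?_
  have h2 := (abs_le.1 (abs_excess_le (h β hβ).1 N.t)).2
  have h3 := (abs_le.1 (abs_excess_le r.init_isFlow N.t)).1
  linarith

theorem summable_increment_of_forall_lt {α : Ordinal.{0}} (hα : Order.IsSuccLimit α)
    (h : ∀ β < α, r.WellDefinedAt β) (e : E) :
    Summable ((Set.Iio α).indicator fun β => r.increment β (r.flow β) e) := by
  refine Summable.of_norm_bounded (summable_amount_of_forall_lt hα h) fun β => ?_
  rw [norm_indicator_eq_indicator_norm]
  exact Set.indicator_le_indicator (r.abs_increment_le β e)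

theorem hasSum_of_forall_lt {α : Ordinal.{0}} (hα : Order.IsSuccLimit α)
    (h : ∀ β < α, r.WellDefinedAt β) (e : E) :
    HasSum ((Set.Iio α).indicator fun β => r.increment β (r.flow β) e)
      (r.flow α e - r.init e) := by
  convert (summable_increment_of_forall_lt hα h e).hasSum using 1
  rw [flow_limit r hα, ← tsum_subtype]
  simp

theorem tendsto_of_forall_lt {α : Ordinal.{0}} (hα : Order.IsSuccLimit α)
    (h : ∀ β < α, r.WellDefinedAt β) (e : E) :
    Tendsto (fun β => r.flow β e) (𝓝[<] α) (𝓝 (r.flow α e)) := by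
  have h1 : Tendsto (fun β => ∑' x, (Set.Iio β).indicator (fun β => r.increment β (r.flow β) e) x)
      (𝓝[<] α) (𝓝 (∑' x, (Set.Iio α).indicator (fun β => r.increment β (r.flow β) e) x)) := by
    refine tendsto_tsum_of_dominated_convergence (summable_amount_of_forall_lt hα h)
      (fun x => ?_) ?_
    · refine tendsto_nhds_of_eventually_eq ?_
      by_cases hx : x < α
      · filter_upwards [mem_nhdsWithin_of_mem_nhds (Ioi_mem_nhds hx)] with β hβ
        rw [Set.indicator_of_mem (Set.mem_Iio.2 hx), Set.indicator_of_mem (Set.mem_Iio.2 hβ)]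
      · filter_upwards [self_mem_nhdsWithin] with β hβ
        rw [Set.indicator_of_notMem (s := Set.Iio α) (by simpa using hx),
          Set.indicator_of_notMem fun h => hx (lt_trans (Set.mem_Iio.1 h) (Set.mem_Iio.1 hβ))]
    · filter_upwards [self_mem_nhdsWithin] with β hβ x
      rw [norm_indicator_eq_indicator_norm]
      by_cases hx : x < β
      · rw [Set.indicator_of_mem (Set.mem_Iio.2 hx),
          Set.indicator_of_mem ((Set.mem_Iio.2 (lt_trans hx (Set.mem_Iio.1 hβ))))]
        exact r.abs_increment_le x e
      · rw [Set.indicator_of_notMem (by simpa using hx)]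
        exact Set.indicator_nonneg (fun β _ => r.amount_nonneg β) x
  rw [(hasSum_of_forall_lt hα h e).tsum_eq] at h1
  have h2 := h1.add_const (r.init e)
  rw [sub_add_cancel] at h2
  refine h2.congr' ?_
  filter_upwards [self_mem_nhdsWithin] with β hβ
  rw [((h β hβ).2 e).tsum_eq, sub_add_cancel]

theorem neBot_nhdsLT {α : Ordinal.{0}} (hα : Order.IsSuccLimit α) : (𝓝[<] α).NeBot := by
  rw [← mem_closure_iff_nhdsWithin_neBot]
  refine IsLUB.mem_closure ⟨fun β hβ => (Set.mem_Iio.1 hβ).le, fun β hβ => ?_⟩ ⟨0, hα.bot_lt⟩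
  by_contra h
  have := hβ (Set.mem_Iio.2 (hα.add_one_lt (not_le.1 h)))
  exact absurd (Order.add_one_le_iff.1 this) (lt_irrefl _)

variable (r)

theorem wellDefinedAt (α : Ordinal.{0}) : r.WellDefinedAt α := by
  induction α using Ordinal.limitRecOn with
  | zero =>
    refine ⟨by rw [flow_zero]; exact r.init_isFlow, fun e => ?_⟩
    rw [flow_zero, sub_self]
    convert hasSum_zero using 1
    funext β
    simp [Set.indicator]
  | add_one α ih => exact ih.succ
  | limit α hα ih =>
    have := neBot_nhdsLT hα
    refine ⟨?_, hasSum_of_forall_lt hα ih⟩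
    refine isClosed_setOf_isFlow.mem_of_tendsto
      (tendsto_pi_nhds.2 fun e => tendsto_of_forall_lt hα ih e) ?_
    filter_upwards [self_mem_nhdsWithin] with β hβ
    exact (ih β hβ).1

theorem isFlow_flow (α : Ordinal.{0}) : N.IsFlow (r.flow α) := (r.wellDefinedAt α).1

theorem summable_increment {α : Ordinal.{0}} (hα : Order.IsSuccLimit α) (e : E) :
    Summable fun β : Set.Iio α => r.increment β.1 (r.flow β.1) e :=
  summable_subtype_iff_indicator.2
    (summable_increment_of_forall_lt hα (fun β _ => r.wellDefinedAt β) e)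

theorem tendsto_flow {α : Ordinal.{0}} (hα : Order.IsSuccLimit α) (e : E) :
    Tendsto (fun β => r.flow β e) (𝓝[<] α) (𝓝 (r.flow α e)) :=
  tendsto_of_forall_lt hα (fun β _ => r.wellDefinedAt β) e

theorem tendsto_residualCap {α : Ordinal.{0}} (hα : Order.IsSuccLimit α) (d : E × Bool) :
    Tendsto (fun β => N.residualCap (r.flow β) d) (𝓝[<] α) (𝓝 (N.residualCap (r.flow α) d)) := by
  unfold residualCap
  split_ifs
  · exact (r.tendsto_flow hα d.1).const_sub _
  · exact r.tendsto_flow hα d.1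

/-- The amounts pushed tend to zero on the way to a limit stage. -/
theorem tendsto_amount {α : Ordinal.{0}} (hα : Order.IsSuccLimit α) :
    Tendsto r.amount (𝓝[<] α) (𝓝 0) := by
  have h1 : Tendsto (fun β => N.excess (r.flow β) N.t) (𝓝[<] α)
      (𝓝 (N.excess (r.flow α) N.t)) := by
    unfold excess
    exact tendsto_finsetSum _ fun e _ => (r.tendsto_flow hα e).mul_const _
  -- The amount at `β` is the net flow into `t` at `β + 1` minus that at `β`; both have the same
  -- limit.
  have h2 : Tendsto (fun β : Ordinal.{0} => β + 1) (𝓝[<] α) (𝓝[<] α) := by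
    refine tendsto_nhdsWithin_iff.2 ⟨?_, ?_⟩
    · refine tendsto_of_tendsto_of_tendsto_of_le_of_le'
        (tendsto_id.mono_left nhdsWithin_le_nhds) tendsto_const_nhds ?_ ?_
      · filter_upwards with β using Order.le_succ β
      · filter_upwards [self_mem_nhdsWithin] with β hβ using (hα.add_one_lt hβ).le
    · filter_upwards [self_mem_nhdsWithin] with β hβ using hα.add_one_lt hβ
  have h3 := (h1.comp h2).sub h1
  rw [sub_self] at h3
  refine h3.congr fun β => ?_
  simp only [Function.comp]
  rw [flow_add_one, ← r.excess_increment]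
  simp [excess, add_mul, Finset.sum_add_distrib]

end Run

end Network

end FordFulkerson

/-! ### The upper bound -/

namespace FordFulkerson

theorem exists_forall_of_eventually_nhdsLT {l : Ordinal.{0}} (hl : Order.IsSuccLimit l)
    {P : Ordinal.{0} → Prop} (h : ∀ᶠ β in 𝓝[<] l, P β) :
    ∃ γ < l, ∀ β, γ ≤ β → β < l → P β := by
  obtain ⟨γ, hγ, hs⟩ := (mem_nhdsLT_iff_exists_Ioo_subset' (Set.mem_Iio.2 hl.bot_lt)).1 h
  exact ⟨γ + 1, hl.add_one_lt hγ, fun β h1 h2 => hs ⟨Order.add_one_le_iff.1 h1, h2⟩⟩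

theorem isSuccLimit_omega0_opow_natCast_add_one (k : ℕ) :
    Order.IsSuccLimit (ω ^ ((k + 1 : ℕ) : Ordinal.{0})) :=
  Ordinal.isSuccLimit_opow_left Ordinal.isSuccLimit_omega0 (by simp)

theorem add_omega0_opow_eq_of_le_of_lt {α γ x : Ordinal.{0}} (h1 : α ≤ γ) (h2 : γ < α + ω ^ x) :
    γ + ω ^ x = α + ω ^ x := by
  obtain ⟨δ, rfl⟩ := exists_add_of_le h1
  rw [add_assoc, Ordinal.add_omega0_opow ((add_lt_add_iff_left α).1 h2)]

theorem add_omega0_opow_lt_of_lt {α γ x y : Ordinal.{0}} (hxy : x < y) (h1 : α ≤ γ)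
    (h2 : γ < α + ω ^ y) : γ + ω ^ x < α + ω ^ y := by
  obtain ⟨δ, rfl⟩ := exists_add_of_le h1
  rw [add_assoc]
  exact (add_lt_add_iff_left α).2 (Ordinal.isPrincipal_add_omega0_opow y
    ((add_lt_add_iff_left α).1 h2) ((Ordinal.opow_lt_opow_iff_right Ordinal.one_lt_omega0).2 hxy))

namespace Network.Run

variable {V E : Type*} {N : Network V E} [Fintype E] (r : N.Run)

/-- In all stages from `α` up to `β` something is pushed, and the bottleneck is at an arc of `S`. -/
def LimitedTo (S : Finset E) (α β : Ordinal.{0}) : Prop :=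
  ∀ γ, α ≤ γ → γ < β → (∃ p, N.IsAugmenting (r.flow γ) p) ∧
    ∃ d ∈ r.choice γ (r.flow γ), d.1 ∈ S ∧ N.residualCap (r.flow γ) d = r.amount γ

variable {r}

theorem LimitedTo.mono {S : Finset E} {α α' β β' : Ordinal.{0}} (h : r.LimitedTo S α β)
    (h1 : α ≤ α') (h2 : β' ≤ β) : r.LimitedTo S α' β' :=
  fun γ h3 h4 => h γ (h1.trans h3) (h4.trans_le h2)

theorem limitedTo_univ {α β : Ordinal.{0}}
    (h : ∀ γ, α ≤ γ → γ < β → ∃ p, N.IsAugmenting (r.flow γ) p) :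
    r.LimitedTo Finset.univ α β := by
  intro γ h1 h2
  have hp := h γ h1 h2
  refine ⟨hp, ?_⟩
  obtain ⟨d, hd, h3⟩ := (isLeast_bottleneck (N := N) (r.flow γ)
    (r.choice_spec γ _ hp).ne_nil).1
  exact ⟨d, hd, Finset.mem_univ _, by rw [h3, amount, if_pos hp]⟩

/-- The bottleneck is saturated by the augmentation. -/
theorem residualCap_add_one_eq_zero {γ : Ordinal.{0}} (hp : ∃ p, N.IsAugmenting (r.flow γ) p)
    {d : E × Bool} (hd : d ∈ r.choice γ (r.flow γ))
    (h : N.residualCap (r.flow γ) d = r.amount γ) :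
    N.residualCap (r.flow (γ + 1)) d = 0 := by
  have hq := r.choice_spec γ _ hp
  rw [flow_add_one]
  obtain ⟨e, b⟩ := d
  unfold residualCap at h ⊢
  dsimp only at h ⊢
  rw [increment_eq]
  cases b
  · simp only [Bool.false_eq_true, if_false] at h ⊢
    rw [sign_false (fun h' => hq.1.not_mem_both hq.2.1 h' hd) hd, h]
    ring
  · simp only [if_true] at h ⊢
    rw [sign_true hd, ← h]
    ring

/-- A bottleneck is saturated right after its step, and amounts tend to zero at a limit; so an arc
with slack in both directions at `l` is not the bottleneck shortly before `l`. -/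
theorem LimitedTo.erase [DecidableEq E] {S : Finset E} {α l : Ordinal.{0}}
    (h : r.LimitedTo S α l) (hαl : α < l) {e : E}
    (he : ∀ b, 0 < N.residualCap (r.flow l) (e, b)) :
    ∃ γ, α ≤ γ ∧ γ < l ∧ r.LimitedTo (S.erase e) γ l := by
  have key : ∀ γ, α ≤ γ → (∀ β, γ ≤ β → β < l → ∀ b, (e, b) ∈ r.choice β (r.flow β) →
      N.residualCap (r.flow β) (e, b) ≠ r.amount β) → r.LimitedTo (S.erase e) γ l := by
    intro γ hγ hne β h1 h2
    obtain ⟨hp, d, hd, hdS, hda⟩ := h β (hγ.trans h1) h2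
    refine ⟨hp, d, hd, Finset.mem_erase.2 ⟨?_, hdS⟩, hda⟩
    rintro rfl
    exact hne β h1 h2 d.2 hd hda
  rcases Ordinal.zero_or_succ_or_isSuccLimit l with rfl | ⟨β, rfl⟩ | hl
  · exact absurd hαl not_lt_zero
  -- Successors matter: `not_limitedTo` applies this at `γ + ω ^ k`, which is `γ + 1` for `k = 0`.
  · rw [Order.succ_eq_add_one] at *
    have hβ := Order.lt_add_one_iff.1 hαl
    refine ⟨β, hβ, Order.lt_add_one_iff.2 le_rfl, key β hβ fun δ h1 h2 b hd hda => ?_⟩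
    obtain rfl := le_antisymm (Order.lt_add_one_iff.1 h2) h1
    exact (he b).ne' (residualCap_add_one_eq_zero (h δ hβ h2).1 hd hda)
  · have hev : ∀ᶠ β in 𝓝[<] l, ∀ b, r.amount β < N.residualCap (r.flow β) (e, b) :=
      eventually_all.2 fun b => (r.tendsto_amount hl).eventually_lt
        (r.tendsto_residualCap hl (e, b)) (he b)
    obtain ⟨γ, hγ, hs⟩ := exists_forall_of_eventually_nhdsLT hl hev
    exact ⟨max α γ, le_max_left _ _, max_lt hαl hγ, key _ (le_max_left _ _) fun β h1 h2 b _ =>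
      (hs β ((le_max_right _ _).trans h1) h2 b).ne'⟩

/-- If the bottleneck is always at one of `k` arcs, then there are less than `ω ^ k` steps. -/
theorem not_limitedTo (k : ℕ) : ∀ (S : Finset E), S.card ≤ k → ∀ α,
    ¬ r.LimitedTo S α (α + ω ^ (k : Ordinal.{0})) := by
  classical
  induction k with
  | zero =>
    intro S hS α h
    obtain ⟨-, d, -, hd, -⟩ := h α le_rfl (by simp)
    simp [Finset.card_eq_zero.1 (Nat.le_zero.1 hS)] at hd
  | succ k ih =>
    intro S hS α h
    set l := α + ω ^ ((k + 1 : ℕ) : Ordinal.{0}) with hl_def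
    have hk : ((k : ℕ) : Ordinal.{0}) < ((k + 1 : ℕ) : Ordinal.{0}) := by simp
    have hl : Order.IsSuccLimit l :=
      Ordinal.isSuccLimit_add _ (isSuccLimit_omega0_opow_natCast_add_one k)
    have hαl : α < l := lt_add_of_pos_right _ (Ordinal.opow_pos _ Ordinal.omega0_pos)
    have hcard : ∀ e ∈ S, (S.erase e).card ≤ k := fun e he => by
      rw [Finset.card_erase_of_mem he]
      omega
    by_cases hfree : ∃ e ∈ S, ∀ b, 0 < N.residualCap (r.flow l) (e, b)
    · obtain ⟨e, heS, he⟩ := hfree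
      obtain ⟨γ, h1, h2, h3⟩ := h.erase hαl he
      exact ih _ (hcard e heS) γ
        (h3.mono le_rfl (add_omega0_opow_lt_of_lt hk h1 h2).le)
    -- Every arc of `S` is now empty or full at `l`: direction `b e` is saturated there, and the
    -- opposite one has the whole capacity.
    · push Not at hfree
      choose! b hb using hfree
      have hb0 : ∀ e ∈ S, N.residualCap (r.flow l) (e, !b e) = N.cap e := by
        intro e he
        have h1 := le_antisymm (hb e he) (residualCap_nonneg (r.isFlow_flow l) _)
        have h2 := residualCap_add_residualCap_not (N := N) (r.flow l) e (b e)
        linarith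
      -- Close to `l`, direction `!b e` has more residual capacity than is pushed, so only `b e` can
      -- be a bottleneck.
      have hev : ∀ᶠ β in 𝓝[<] l, ∀ e ∈ S, 0 < N.cap e →
          r.amount β < N.residualCap (r.flow β) (e, !b e) := by
        refine (Finset.eventually_all S).2 fun e he => ?_
        by_cases hc : 0 < N.cap e
        · filter_upwards [(r.tendsto_amount hl).eventually_lt
            (r.tendsto_residualCap hl (e, !b e)) (by rwa [hb0 e he])] with β hβ _ using hβ
        · exact Eventually.of_forall fun β h => absurd h hc
      obtain ⟨γ₀, hγ₀, hs⟩ := exists_forall_of_eventually_nhdsLT hl hev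
      set γ := max α γ₀
      have hγl : γ < l := max_lt hαl hγ₀
      -- A stage still before `l`, but preceded by enough steps for the induction hypothesis.
      set l' := γ + ω ^ (k : Ordinal.{0})
      have hl' : l' < l := add_omega0_opow_lt_of_lt hk (le_max_left _ _) hγl
      have hγl' : γ < l' := lt_add_of_pos_right _ (Ordinal.opow_pos _ Ordinal.omega0_pos)
      by_cases hfree' : ∃ e ∈ S, ∀ b, 0 < N.residualCap (r.flow l') (e, b)
      · obtain ⟨e, heS, he⟩ := hfree'
        obtain ⟨δ, h1, h2, h3⟩ := (h.mono (le_max_left α γ₀) hl'.le).erase hγl' he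
        refine ih _ (hcard e heS) δ ?_
        -- Any tail of the interval from `γ` to `l'` still has length `ω ^ k`.
        rwa [add_omega0_opow_eq_of_le_of_lt h1 h2]
      -- At `l'` each arc of `S` is saturated in some direction. For the bottleneck arc this is not
      -- `!b`, where the residual capacity exceeds the amount, hence it is `b`; so neither direction
      -- can be the bottleneck of the step at `l'`.
      · push Not at hfree'
        obtain ⟨hp, d, hd, hdS, hda⟩ := h l' ((le_max_left α γ₀).trans hγl'.le) hl'
        have hdpos : 0 < N.residualCap (r.flow l') d := hda ▸ r.amount_pos hp
        have hcap : 0 < N.cap d.1 := by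
          have h1 := residualCap_add_residualCap_not (N := N) (r.flow l') d.1 d.2
          have h2 := residualCap_nonneg (r.isFlow_flow l') (d.1, !d.2)
          have h3 : N.residualCap (r.flow l') (d.1, d.2) = N.residualCap (r.flow l') d := rfl
          linarith
        have hlt := hs l' ((le_max_right α γ₀).trans hγl'.le) hl' d.1 hdS hcap
        obtain ⟨c, hc⟩ := hfree' d.1 hdS
        by_cases hdb : d.2 = !b d.1
        · exact hlt.ne' (by rw [← hdb]; exact hda)
        · have hdb' : d.2 = b d.1 := by
            revert hdb
            cases d.2 <;> cases b d.1 <;> simp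
          by_cases hcb : c = d.2
          · subst hcb
            exact absurd hdpos (not_lt.2 hc)
          · have hcb' : c = !b d.1 := by
              rw [← hdb']
              revert hcb
              cases c <;> cases d.2 <;> simp
            rw [hcb'] at hc
            exact absurd (hlt.trans_le hc) (not_lt.2 (r.amount_nonneg l'))

/-- An actual augmentation changes the flow, since it strictly increases the net flow into `t`. -/
theorem flow_eq_flow_add_one_iff {β : Ordinal.{0}} :
    r.flow β = r.flow (β + 1) ↔ ¬ ∃ p, N.IsAugmenting (r.flow β) p := by
  constructor
  · intro h hp
    have h1 := r.excess_increment β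
    have h2 : r.increment β (r.flow β) = 0 := by
      funext e
      have := congrFun h e
      rw [flow_add_one] at this
      simpa using this
    rw [h2] at h1
    simp only [excess, Pi.zero_apply, zero_mul, Finset.sum_const_zero] at h1
    exact (r.amount_pos hp).ne h1
  · intro h
    rw [flow_add_one]
    funext e
    simp [increment, h]

variable (r)

theorem exists_lt_flow_eq : ∃ α < ω ^ (Fintype.card E : Ordinal.{0}),
    r.flow α = r.flow (α + 1) := by
  by_contra! h
  refine not_limitedTo (r := r) _ Finset.univ le_rfl 0 (limitedTo_univ fun γ _ h2 => ?_)
  rw [zero_add] at h2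
  exact not_not.1 fun h3 => h γ h2 (flow_eq_flow_add_one_iff.2 h3)

theorem terminates : r.Terminates :=
  let ⟨α, _, h⟩ := r.exists_lt_flow_eq
  ⟨α, h⟩

theorem runTime_le : r.runTime ≤ ω ^ (Fintype.card E : Ordinal.{0}) :=
  let ⟨α, h1, h2⟩ := r.exists_lt_flow_eq
  (csInf_le' (show α ∈ {α | r.flow α = r.flow (α + 1)} from h2)).trans h1.le

theorem le_runTime {γ : Ordinal.{0}} (h : ∀ β < γ, ∃ p, N.IsAugmenting (r.flow β) p) :
    γ ≤ r.runTime :=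
  le_csInf r.terminates fun β hβ => not_lt.1 fun hlt =>
    flow_eq_flow_add_one_iff.1 hβ (h β hlt)

end Network.Run

end FordFulkerson

/-! ### Concatenating runs -/

namespace FordFulkerson.Network

variable {V E : Type*} {N : Network V E} [Fintype E]

namespace Run

/-- A run that makes the same choices as `r` from stage `Γ` on shadows `r`. -/
theorem flow_add_eq {R r : N.Run} {Γ γ : Ordinal.{0}} (h0 : R.flow Γ = r.init)
    (h : ∀ β < γ, R.choice (Γ + β) = r.choice β) {β : Ordinal.{0}} (hβ : β ≤ γ) :
    R.flow (Γ + β) = r.flow β := by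
  induction β using Ordinal.limitRecOn with
  | zero => rw [add_zero, flow_zero, h0]
  | add_one β ih =>
    have hlt := Order.add_one_le_iff.1 hβ
    rw [← add_assoc, flow_add_one, flow_add_one, ih hlt.le]
    unfold increment
    rw [h β hlt]
  | limit β hl ih =>
    have := neBot_nhdsLT hl
    -- Left addition is continuous, so both runs have the same limit along matching stages.
    have ht : Tendsto (fun δ => Γ + δ) (𝓝[<] β) (𝓝[<] (Γ + β)) := by
      refine tendsto_nhdsWithin_iff.2 ⟨?_, ?_⟩
      · exact (Ordinal.isNormal_add_right Γ).continuous.continuousAt.mono_left nhdsWithin_le_nhds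
      · filter_upwards [self_mem_nhdsWithin] with δ hδ using (add_lt_add_iff_left Γ).2 hδ
    funext e
    refine tendsto_nhds_unique
      ((R.tendsto_flow (Ordinal.isSuccLimit_add Γ hl) e).comp ht)
      ((r.tendsto_flow hl e).congr' ?_)
    filter_upwards [self_mem_nhdsWithin] with δ hδ
    have hδ' := Set.mem_Iio.1 hδ
    simp only [Function.comp, ih δ hδ' (hδ'.le.trans hβ)]

end Run

variable (N)

/-- There is a run from `f` that pushes something in each of the first `γ` stages and is at `g`
then. -/
def Reaches (f : E → ℝ) (γ : Ordinal.{0}) (g : E → ℝ) : Prop :=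
  ∃ r : N.Run, r.init = f ∧ r.flow γ = g ∧ ∀ β < γ, ∃ p, N.IsAugmenting (r.flow β) p

variable {N}

theorem Reaches.isFlow_right {f g : E → ℝ} {γ : Ordinal.{0}} (h : N.Reaches f γ g) :
    N.IsFlow g := by
  obtain ⟨r, -, rfl, -⟩ := h
  exact r.isFlow_flow γ

open Classical in
theorem Reaches.of_isAugmenting {f : E → ℝ} (hf : N.IsFlow f) {p : List (E × Bool)}
    (hp : N.IsAugmenting f p) :
    N.Reaches f 1 fun e => f e + sign p e * N.bottleneck f p := by
  let r : N.Run :=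
    { init := f
      init_isFlow := hf
      choice := fun _ g => if N.IsAugmenting g p then p else
        if h : ∃ q, N.IsAugmenting g q then h.choose else []
      choice_spec := fun _ g h => by
        split_ifs with h1
        · exact h1
        · exact h.choose_spec }
  have h0 : r.flow 0 = f := r.flow_zero
  refine ⟨r, rfl, ?_, fun β hβ => ?_⟩
  · rw [← zero_add 1, r.flow_add_one, h0]
    funext e
    rw [Run.increment, if_pos ⟨p, hp⟩]
    simp only [r, if_pos hp]
  · rw [Order.lt_one_iff.1 hβ, h0]
    exact ⟨p, hp⟩

theorem Reaches.trans {f g h : E → ℝ} {γ δ : Ordinal.{0}} (h1 : N.Reaches f γ g)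
    (h2 : N.Reaches g δ h) : N.Reaches f (γ + δ) h := by
  classical
  obtain ⟨r, rfl, rfl, hr⟩ := h1
  obtain ⟨r', hi, rfl, hr'⟩ := h2
  let R : N.Run :=
    { init := r.init
      init_isFlow := r.init_isFlow
      choice := fun β => if β < γ then r.choice β else r'.choice (β - γ)
      choice_spec := fun β f hf => by
        split_ifs
        · exact r.choice_spec β f hf
        · exact r'.choice_spec _ f hf }
  have hR1 : ∀ β ≤ γ, R.flow β = r.flow β := fun β hβ => by
    have := Run.flow_add_eq (R := R) (r := r) R.flow_zero (fun β hβ => by simp [R, hβ]) hβ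
    rwa [zero_add] at this
  have hR2 : ∀ β ≤ δ, R.flow (γ + β) = r'.flow β := fun β hβ =>
    Run.flow_add_eq ((hR1 γ le_rfl).trans hi.symm) (fun β _ => by simp [R]) hβ
  refine ⟨R, rfl, hR2 δ le_rfl, fun β hβ => ?_⟩
  by_cases hβγ : β < γ
  · rw [hR1 β hβγ.le]
    exact hr β hβγ
  · obtain ⟨ε, rfl⟩ := exists_add_of_le (not_lt.1 hβγ)
    have hε := (add_lt_add_iff_left γ).1 hβ
    rw [hR2 ε hε.le]
    exact hr' ε hε

/-- Infinitely many runs one after the other. -/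
theorem Reaches.exists_limit {f : ℕ → E → ℝ} {γ : ℕ → Ordinal.{0}} {δ : Ordinal.{0}}
    (h : ∀ i, N.Reaches (f i) (γ i) (f (i + 1))) (hδ : 0 < δ) (hγ : ∀ i, δ ≤ γ i) :
    ∃ γ' g, N.Reaches (f 0) γ' g ∧ δ * ω ≤ γ' ∧
      ∀ e, Tendsto (fun i => f i e) atTop (𝓝 (g e)) := by
  classical
  choose r hr0 hr1 hr2 using h
  let Γ : ℕ → Ordinal.{0} := fun i => Nat.rec 0 (fun i x => x + γ i) i
  have hΓs : ∀ i, Γ (i + 1) = Γ i + γ i := fun i => rfl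
  have hΓm : StrictMono Γ := strictMono_nat_of_lt_succ fun i => by
    rw [hΓs]
    exact lt_add_of_pos_right _ (hδ.trans_le (hγ i))
  -- The block that contains stage `β`: block `i` runs from `Γ i` to `Γ (i + 1)`.
  let idx : Ordinal.{0} → ℕ := fun β => sInf {i | β < Γ (i + 1)}
  have hidx : ∀ i β, β < γ i → idx (Γ i + β) = i := by
    intro i β hβ
    refine le_antisymm (Nat.sInf_le ?_) (le_csInf ⟨i, ?_⟩ fun j hj => ?_)
    · exact (add_lt_add_iff_left _).2 hβ
    · exact (add_lt_add_iff_left _).2 hβ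
    · by_contra! hji
      exact absurd ((hΓm.monotone hji).trans le_self_add) (not_le.2 hj)
  let R : N.Run :=
    { init := f 0
      init_isFlow := hr0 0 ▸ (r 0).init_isFlow
      choice := fun β => (r (idx β)).choice (β - Γ (idx β))
      choice_spec := fun β g hg => (r (idx β)).choice_spec _ g hg }
  have hRc : ∀ i, ∀ β < γ i, R.choice (Γ i + β) = (r i).choice β := by
    intro i β hβ
    simp [R, hidx i β hβ]
  have hRΓ : ∀ i, R.flow (Γ i) = f i := by
    intro i
    induction i with
    | zero => exact R.flow_zero
    | succ i ih =>
      rw [hΓs, Run.flow_add_eq (ih.trans (hr0 i).symm) (hRc i) le_rfl, hr1]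
  have hR : ∀ i, ∀ β ≤ γ i, R.flow (Γ i + β) = (r i).flow β := fun i β hβ =>
    Run.flow_add_eq ((hRΓ i).trans (hr0 i).symm) (hRc i) hβ
  have hbdd : BddAbove (Set.range Γ) := Ordinal.bddAbove_of_small
  have hlt : ∀ i, Γ i < ⨆ i, Γ i := fun i =>
    (hΓm (Nat.lt_succ_self i)).trans_le (le_ciSup hbdd (i + 1))
  have hlim : Order.IsSuccLimit (⨆ i, Γ i) := by
    rw [Ordinal.isSuccLimit_iff, Order.isSuccPrelimit_iff_succ_lt]
    refine ⟨(bot_le.trans_lt (hlt 0)).ne', fun β hβ => ?_⟩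
    obtain ⟨i, hi⟩ := exists_lt_of_lt_ciSup hβ
    exact (Order.add_one_le_iff.2 hi).trans_lt (hlt i)
  refine ⟨⨆ i, Γ i, _, ⟨R, rfl, rfl, fun β hβ => ?_⟩, ?_, fun e => ?_⟩
  · have hex : ∃ i, β < Γ i := exists_lt_of_lt_ciSup hβ
    obtain ⟨i, hi⟩ : ∃ i, Nat.find hex = i + 1 := Nat.exists_eq_succ_of_ne_zero fun h0 => by
      exact absurd (h0 ▸ Nat.find_spec hex : β < Γ 0) not_lt_zero
    have h1 := Nat.find_spec hex
    have h2 := not_lt.1 (Nat.find_min hex (show i < Nat.find hex by omega))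
    rw [hi, hΓs] at h1
    obtain ⟨ε, rfl⟩ := exists_add_of_le h2
    have hε := (add_lt_add_iff_left _).1 h1
    rw [hR i ε hε.le]
    exact hr2 i ε hε
  · refine (Ordinal.mul_le_iff_of_isSuccLimit Ordinal.isSuccLimit_omega0).2 fun x hx => ?_
    obtain ⟨n, rfl⟩ := Ordinal.lt_omega0.1 hx
    refine le_trans ?_ (hlt n).le
    induction n with
    | zero => simp
    | succ n ih =>
      rw [hΓs, Nat.cast_add_one, mul_add_one]
      exact add_le_add (ih (Ordinal.natCast_lt_omega0 n)) (hγ n)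
  · refine ((R.tendsto_flow hlim e).comp (tendsto_nhdsWithin_iff.2
      ⟨tendsto_atTop_ciSup hΓm.monotone hbdd, Eventually.of_forall hlt⟩)).congr fun i => ?_
    simp only [Function.comp, hRΓ]

theorem Reaches.exists_run {f g : E → ℝ} {γ : Ordinal.{0}} (h : N.Reaches f γ g) :
    ∃ r : N.Run, r.Terminates ∧ γ ≤ r.runTime := by
  obtain ⟨r, -, -, hr⟩ := h
  exact ⟨r, r.terminates, r.le_runTime hr⟩

end FordFulkerson.Network

/-! ### Chains of bridges as counters -/

namespace FordFulkerson.Network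

section Walk

variable {V E : Type*} {N : Network V E}

theorem IsWalk.append {u v w : V} {p q : List (E × Bool)} (h1 : N.IsWalk u v p)
    (h2 : N.IsWalk v w q) : N.IsWalk u w (p ++ q) := by
  induction p generalizing u with
  | nil => cases (show u = v from h1); exact h2
  | cons d p ih => exact ⟨h1.1, ih h1.2⟩

/-- A walk along which some potential increases visits no vertex twice. -/
theorem IsWalk.nodup_of_lt {u v : V} {p : List (E × Bool)} (h : N.IsWalk u v p) (φ : V → ℕ)
    (hφ : ∀ d ∈ p, φ (N.stepSrc d) < φ (N.stepTgt d)) : (u :: p.map N.stepTgt).Nodup := by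
  suffices h' : (∀ x ∈ p.map N.stepTgt, φ u < φ x) ∧ (p.map N.stepTgt).Nodup from
    List.nodup_cons.2 ⟨fun hu => lt_irrefl _ (h'.1 u hu), h'.2⟩
  induction p generalizing u with
  | nil => simp
  | cons d p ih =>
    obtain ⟨h1, h2⟩ := h
    have h3 := hφ d (by simp)
    rw [h1] at h3
    obtain ⟨h4, h5⟩ := ih h2 fun d' hd' => hφ d' (List.mem_cons_of_mem _ hd')
    rw [List.map_cons]
    refine ⟨fun x hx => ?_, List.nodup_cons.2 ⟨fun hd => lt_irrefl _ (h4 _ hd), h5⟩⟩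
    rcases List.mem_cons.1 hx with rfl | hx
    · exact h3
    · exact h3.trans (h4 x hx)

end Walk

/-- A chain of `n` bridges, with `d` further arcs that lead from the source to dead ends. The
`i`-th bridge leads from `(i, 0)` to `(i + 1, 0)`; its crossbar is the arc from `(i, 1)` to
`(i, 2)`. All arcs have capacity `M`. -/
def chain (n d : ℕ) (M : ℝ) (hn : 0 < n) (hM : 0 ≤ M) :
    Network (Fin (n + 1) × Fin 3 ⊕ Fin d) (Fin n × Fin 5 ⊕ Fin d) where
  src := Sum.elim (fun e => Sum.inl (e.1.castSucc, (![0, 0, 1, 1, 2] : Fin 5 → Fin 3) e.2))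
    fun _ => Sum.inl (0, 0)
  tgt := Sum.elim (fun e => Sum.inl
    ((![e.1.castSucc, e.1.castSucc, e.1.castSucc, e.1.succ, e.1.succ] : Fin 5 → Fin (n + 1)) e.2,
      (![1, 2, 2, 0, 0] : Fin 5 → Fin 3) e.2)) Sum.inr
  cap := fun _ => M
  cap_nonneg := fun _ => hM
  s := Sum.inl (0, 0)
  t := Sum.inl (Fin.last n, 0)
  s_ne_t := by
    intro h
    have := congrArg Fin.val (Prod.ext_iff.1 (Sum.inl.inj h)).1
    simp at this
    omega

namespace chain

variable {n d : ℕ}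

theorem isSimple (M : ℝ) (hn : 0 < n) (hM : 0 ≤ M) : (chain n d M hn hM).IsSimple := by
  refine ⟨?_, ?_⟩
  · rintro (⟨i, c⟩ | j)
    · fin_cases c <;> simp [chain, Fin.ext_iff]
    · simp [chain]
  · rintro (⟨i, c⟩ | j) (⟨i', c'⟩ | j')
    · fin_cases c <;> fin_cases c' <;> simp [chain, Fin.ext_iff]
    · simp [chain]
    · simp [chain]
    · simp [chain]

/-- The flow along the crossbar of the `m`-th bridge. -/
noncomputable def counter (f : Fin n × Fin 5 ⊕ Fin d → ℝ) (m : ℕ) : ℝ :=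
  if h : m < n then f (Sum.inl (⟨m, h⟩, 2)) else 0

/-- The flow of value `1` with flow `x m` along the crossbar of the `m`-th bridge. -/
def start (n d : ℕ) (x : ℕ → ℝ) : Fin n × Fin 5 ⊕ Fin d → ℝ :=
  Sum.elim (fun e => ![1, 0, x e.1, 1 - x e.1, x e.1] e.2) 0

theorem counter_start (x : ℕ → ℝ) {m : ℕ} (hm : m < n) :
    counter (start n d x) m = x m := by
  simp [counter, start, hm]

theorem start_mem_Icc {x : ℕ → ℝ} (hx : ∀ m, 0 ≤ x m ∧ x m ≤ 1) (e : Fin n × Fin 5 ⊕ Fin d) :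
    0 ≤ start n d x e ∧ start n d x e ≤ 1 := by
  rcases e with ⟨i, c⟩ | j
  · have := hx i
    fin_cases c <;> simp [start, this]
  · simp [start]

theorem isFlow_start {M : ℝ} (hn : 0 < n) (hM : 1 ≤ M) {x : ℕ → ℝ}
    (hx : ∀ m, 0 ≤ x m ∧ x m ≤ 1) :
    (chain n d M hn (zero_le_one.trans hM)).IsFlow (start n d x) := by
  classical
  refine ⟨fun e => ⟨(start_mem_Icc hx e).1, (start_mem_Icc hx e).2.trans hM⟩, fun u hs ht => ?_⟩
  rw [Finset.sum_filter, Finset.sum_filter]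
  simp only [Fintype.sum_sum_type, Fintype.sum_prod_type, Fin.sum_univ_five]
  rcases u with ⟨i, c⟩ | j
  · simp only [chain, start, Sum.elim_inl, Sum.elim_inr, Pi.zero_apply]
    fin_cases c
    · have h0 : i ≠ 0 := by
        rintro rfl
        exact hs rfl
      have hl : i ≠ Fin.last n := by
        rintro rfl
        exact ht rfl
      obtain ⟨a, rfl⟩ := Fin.exists_succ_eq.2 h0
      obtain ⟨b, hb⟩ := Fin.exists_castSucc_eq.2 hl
      have h1 : ∀ y : Fin n, (y.castSucc = a.succ) ↔ y = b := fun y => by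
        rw [← hb, Fin.castSucc_inj]
      simp [Fin.succ_inj, h1, Finset.sum_add_distrib]
    · refine congrArg₂ (· + ·) (Finset.sum_congr rfl fun y _ => ?_) (by simp)
      by_cases h : y.castSucc = i <;> simp [h]
    · refine congrArg₂ (· + ·) (Finset.sum_congr rfl fun y _ => ?_) (by simp)
      by_cases h : y.castSucc = i <;> simp [h]
  · simp [chain, start]

/-- The part of an augmenting path in the `i`-th bridge: the crossbar is traversed backwards if
the sign is `1`, forwards if it is `-1`, and not at all if it is `0`. -/
def bridgePath (i : Fin n) : SignType → List ((Fin n × Fin 5 ⊕ Fin d) × Bool)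
  | .zero => [(Sum.inl (i, 0), true), (Sum.inl (i, 3), true)]
  | .pos => [(Sum.inl (i, 1), true), (Sum.inl (i, 2), false), (Sum.inl (i, 3), true)]
  | .neg => [(Sum.inl (i, 0), true), (Sum.inl (i, 2), true), (Sum.inl (i, 4), true)]

/-- The path through the first `m` bridges with prescribed signs. -/
def path (d : ℕ) (σ : ℕ → SignType) : (m : ℕ) → m ≤ n →
    List ((Fin n × Fin 5 ⊕ Fin d) × Bool)
  | 0, _ => []
  | m + 1, h => path d σ m (Nat.le_of_succ_le h) ++ bridgePath ⟨m, h⟩ (σ m)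

theorem mem_path {σ : ℕ → SignType} {m : ℕ} {h : m ≤ n}
    {a : (Fin n × Fin 5 ⊕ Fin d) × Bool} :
    a ∈ path d σ m h ↔ ∃ i : Fin n, (i : ℕ) < m ∧ a ∈ bridgePath i (σ i) := by
  induction m with
  | zero => simp [path]
  | succ m ih =>
    rw [path, List.mem_append, ih]
    constructor
    · rintro (⟨i, hi, ha⟩ | ha)
      · exact ⟨i, by omega, ha⟩
      · exact ⟨⟨m, h⟩, Nat.lt_succ_self m, ha⟩
    · rintro ⟨i, hi, ha⟩
      rcases Nat.lt_succ_iff_lt_or_eq.1 hi with hi | hi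
      · exact Or.inl ⟨i, hi, ha⟩
      · right
        have : i = ⟨m, h⟩ := Fin.ext hi
        subst this
        exact ha

variable {M : ℝ} {hn : 0 < n} {hM : 0 ≤ M}

theorem isWalk_path (σ : ℕ → SignType) (m : ℕ) (h : m ≤ n) :
    (chain n d M hn hM).IsWalk (Sum.inl (0, 0)) (Sum.inl (⟨m, Nat.lt_succ_of_le h⟩, 0))
      (path d σ m h) := by
  induction m with
  | zero => rfl
  | succ m ih =>
    refine (ih (Nat.le_of_succ_le h)).append ?_
    cases σ m <;> simp [bridgePath, IsWalk, chain, stepSrc, stepTgt]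

/-- A potential that increases along `path d σ n`. -/
def potential (σ : ℕ → SignType) : Fin (n + 1) × Fin 3 ⊕ Fin d → ℕ :=
  Sum.elim (fun v => 3 * v.1 + ![0, if σ v.1 = 1 then 2 else 1, if σ v.1 = 1 then 1 else 2] v.2) 0

theorem nodup_path (σ : ℕ → SignType) :
    (Sum.inl (0, 0) :: (path d σ n le_rfl).map (chain n d M hn hM).stepTgt).Nodup := by
  refine (isWalk_path σ n le_rfl).nodup_of_lt (potential σ) fun a ha => ?_
  obtain ⟨i, -, ha⟩ := mem_path.1 ha
  rcases hσ : σ i <;> rw [hσ] at ha <;>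
    simp only [bridgePath, List.mem_cons, List.not_mem_nil, or_false] at ha <;>
    rcases ha with rfl | rfl | rfl <;>
    simp [potential, chain, stepSrc, stepTgt, hσ] <;>
    omega

theorem sign_path (σ : ℕ → SignType) (i : Fin n) :
    sign (path d σ n le_rfl) (Sum.inl (i, 2)) = -(σ i : ℝ) := by
  have h : ∀ b, (Sum.inl (i, 2), b) ∈ path d σ n le_rfl ↔
      (b = true ∧ σ i = -1) ∨ (b = false ∧ σ i = 1) := by
    intro b
    rw [mem_path]
    constructor
    · rintro ⟨j, -, hj⟩
      rcases hσ : σ j <;> rw [hσ] at hj <;> simp [bridgePath] at hj <;>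
        obtain ⟨rfl, rfl⟩ := hj <;> simp [hσ]
    · rintro (⟨rfl, h⟩ | ⟨rfl, h⟩)
      · exact ⟨i, i.2, by rw [h]; exact List.mem_cons_of_mem _ (List.mem_cons_self ..)⟩
      · exact ⟨i, i.2, by rw [h]; exact List.mem_cons_of_mem _ (List.mem_cons_self ..)⟩
  unfold sign
  simp only [h]
  rcases hσ : σ i <;> simp

/-- One augmentation moves `b` out of the counters in `P` and into the counters in `Q`, if `b` is
the minimum of the counters in `P`. -/
theorem exists_move {f : Fin n × Fin 5 ⊕ Fin d → ℝ} (hf : (chain n d M hn hM).IsFlow f)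
    (P Q : ℕ → Prop) {b : ℝ} (hb : 0 < b) (hfM : ∀ e, f e + b ≤ M)
    (hle : ∀ m < n, P m → b ≤ counter f m) (hex : ∃ m < n, P m ∧ counter f m = b) :
    ∃ g, (chain n d M hn hM).Reaches f 1 g ∧ (∀ e, g e ≤ f e + b) ∧
      (∀ m < n, P m → counter g m = counter f m - b) ∧
      (∀ m < n, ¬ P m → Q m → counter g m = counter f m + b) ∧
      ∀ m < n, ¬ P m → ¬ Q m → counter g m = counter f m := by
  classical
  let σ : ℕ → SignType := fun m => if P m then 1 else if Q m then -1 else 0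
  have hσ : ∀ m, σ m = 1 ↔ P m := fun m => by
    simp only [σ]
    split_ifs <;> simp [*]
  have hres : ∀ a ∈ path d σ n le_rfl, b ≤ (chain n d M hn hM).residualCap f a := by
    intro a ha
    obtain ⟨e, c⟩ := a
    cases c
    · obtain ⟨i, -, ha⟩ := mem_path.1 ha
      -- The only backward steps are along crossbars of sign `1`, whose residual capacity is the
      -- counter.
      rcases hs : σ i <;> rw [hs] at ha <;> simp [bridgePath] at ha
      have := hle i i.2 ((hσ i).1 hs)
      simpa [residualCap, ha, counter] using this
    · simp only [residualCap, if_true, chain]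
      linarith [hfM e]
  have hp : (chain n d M hn hM).IsAugmenting f (path d σ n le_rfl) :=
    ⟨isWalk_path σ n le_rfl, nodup_path σ, fun a ha => hb.trans_le (hres a ha)⟩
  have hbot : (chain n d M hn hM).bottleneck f (path d σ n le_rfl) = b := by
    obtain ⟨m, hm, hPm, hmb⟩ := hex
    refine IsLeast.csInf_eq ⟨⟨(Sum.inl (⟨m, hm⟩, 2), false), ?_, ?_⟩, ?_⟩
    · refine mem_path.2 ⟨⟨m, hm⟩, hm, ?_⟩
      rw [(hσ m).2 hPm]
      exact List.mem_cons_of_mem _ (List.mem_cons_self ..)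
    · simpa [residualCap, counter, hm] using hmb
    · rintro _ ⟨a, ha, rfl⟩
      exact hres a ha
  have hc : ∀ m < n, counter (fun e => f e + sign (path d σ n le_rfl) e * b) m =
      counter f m - σ m * b := by
    intro m hm
    simp only [counter, hm, dif_pos, sign_path]
    ring
  have hreach := Reaches.of_isAugmenting hf hp
  rw [hbot] at hreach
  refine ⟨_, hreach, fun e => ?_, fun m hm h1 => ?_, fun m hm h1 h2 => ?_, fun m hm h1 h2 => ?_⟩
  · have := (abs_le.1 (abs_sign_le (path d σ n le_rfl) e)).2
    nlinarith
  · rw [hc m hm]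
    simp [σ, h1]
  · rw [hc m hm]
    simp [σ, h1, h2]
  · rw [hc m hm]
    simp [σ, h1, h2]

end chain

end FordFulkerson.Network

/-! ### Emptying the counters level by level -/

namespace FordFulkerson

namespace Network

/-- Infinitely many runs one after the other, given by an invariant. -/
theorem Reaches.exists_limit_of_invariant {V E : Type*} {N : Network V E} [Fintype E]
    {Inv : ℕ → (E → ℝ) → Prop} {f : E → ℝ} {δ : Ordinal.{0}} (hδ : 0 < δ) (h0 : Inv 0 f)
    (hs : ∀ i f, Inv i f → ∃ γ g, N.Reaches f γ g ∧ δ ≤ γ ∧ Inv (i + 1) g) :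
    ∃ γ' g, N.Reaches f γ' g ∧ δ * ω ≤ γ' ∧
      ∃ F : ℕ → E → ℝ, (∀ i, Inv i (F i)) ∧ ∀ e, Tendsto (fun i => F i e) atTop (𝓝 (g e)) := by
  choose γ nxt h1 h2 h3 using hs
  let F : ∀ i, {f // Inv i f} := fun i =>
    Nat.rec ⟨f, h0⟩ (fun i x => ⟨nxt i x.1 x.2, h3 i x.1 x.2⟩) i
  obtain ⟨γ', g, hr, hγ, ht⟩ := Reaches.exists_limit (f := fun i => (F i).1)
    (fun i => h1 i (F i).1 (F i).2) hδ fun i => h2 i (F i).1 (F i).2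
  exact ⟨γ', g, hr, hγ, fun i => (F i).1, fun i => (F i).2, ht⟩

namespace chain

variable {n d : ℕ} {M : ℝ} {hn : 0 < n} {hM : 0 ≤ M}

/-- The three counters of level `j` are `c`, `ρ * c` and `0`, and those of the levels below are
`0`. -/
def IsReady (ρ : ℝ) (f : Fin n × Fin 5 ⊕ Fin d → ℝ) (j : ℕ) (c : ℝ) : Prop :=
  counter f (3 * j) = c ∧ counter f (3 * j + 1) = ρ * c ∧ counter f (3 * j + 2) = 0 ∧
    ∀ m < 3 * j, counter f m = 0

/-- The counters of level `j` can be emptied in at least `ω ^ (j + 1)` steps, without touching the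
levels above. -/
def CanEmpty (n d : ℕ) (M : ℝ) (hn : 0 < n) (hM : 0 ≤ M) (ρ : ℝ) (j : ℕ) : Prop :=
  ∀ (f : Fin n × Fin 5 ⊕ Fin d → ℝ) (c : ℝ), (chain n d M hn hM).IsFlow f → 0 < c →
    IsReady ρ f j c → (∀ e, f e + 2 * (j + 1) * c ≤ M) →
    ∃ γ g, (chain n d M hn hM).Reaches f γ g ∧ ω ^ ((j + 1 : ℕ) : Ordinal.{0}) ≤ γ ∧
      (∀ m < 3 * j + 3, counter g m = 0) ∧
      (∀ m < n, 3 * j + 3 ≤ m → counter g m = counter f m) ∧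
      ∀ e, g e ≤ f e + 2 * (j + 1) * c

/-- Three steps on level `j` that shrink its counters by `ρ ^ 3` and refill the level below. -/
theorem exists_three_moves {ρ : ℝ} (hρ0 : 0 < ρ) (hρ : ρ ^ 2 = 1 - ρ) {j : ℕ}
    (hj : 3 * j + 3 ≤ n) {f : Fin n × Fin 5 ⊕ Fin d → ℝ} {c : ℝ}
    (hf : (chain n d M hn hM).IsFlow f) (hc : 0 < c) (hr : IsReady ρ f j c)
    (hfM : ∀ e, f e + 2 * ρ * c ≤ M) :
    ∃ g, (chain n d M hn hM).Reaches f 3 g ∧ (∀ e, g e ≤ f e + 2 * ρ * c) ∧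
      counter g (3 * j) = ρ ^ 3 * c ∧ counter g (3 * j + 1) = ρ * (ρ ^ 3 * c) ∧
      counter g (3 * j + 2) = 0 ∧ (∀ m < n, 3 * j + 3 ≤ m → counter g m = counter f m) ∧
      (∀ m < 3 * j, counter g m = if m + 3 = 3 * j then ρ * c else
        if m + 2 = 3 * j then ρ * (ρ * c) else 0) := by
  obtain ⟨r0, r1, r2, r3⟩ := hr
  have hρ3 : ρ ^ 3 = 2 * ρ - 1 := by linear_combination (ρ - 1) * hρ
  have hb1 : 0 < ρ * c := mul_pos hρ0 hc
  have hb2 : 0 < ρ ^ 2 * c := by positivity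
  have hb3 : 0 < ρ ^ 3 * c := by positivity
  have hsum : ρ * c + ρ ^ 2 * c + ρ ^ 3 * c = 2 * ρ * c := by rw [hρ3, hρ]; ring
  have e1 : c - ρ * c = ρ ^ 2 * c := by rw [hρ]; ring
  have e2 : ρ * c - ρ ^ 2 * c = ρ ^ 3 * c := by rw [hρ3, hρ]; ring
  have e3 : ρ ^ 2 * c - ρ ^ 3 * c = ρ * (ρ ^ 3 * c) := by linear_combination -ρ ^ 2 * c * hρ
  -- Move 1 pushes `ρ c`: level `j` becomes `(ρ² c, 0, ρ c)`, and the first counter of the level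
  -- below receives `ρ c`.
  obtain ⟨f1, hf1, f1le, f1P, f1Q, f1R⟩ := exists_move hf
    (fun m => m = 3 * j ∨ m = 3 * j + 1) (fun m => m = 3 * j + 2 ∨ m + 3 = 3 * j) hb1
    (fun e => by linarith [hfM e])
    (by
      rintro m hm (rfl | rfl)
      · rw [r0]; linarith
      · rw [r1])
    ⟨3 * j + 1, by omega, Or.inr rfl, r1⟩
  have f10 := f1P (3 * j) (by omega) (Or.inl rfl)
  have f11 := f1P (3 * j + 1) (by omega) (Or.inr rfl)
  have f12 := f1Q (3 * j + 2) (by omega) (by omega) (Or.inl rfl)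
  rw [r0, e1] at f10
  rw [r1, sub_self] at f11
  rw [r2, zero_add] at f12
  -- Move 2 pushes `ρ² c`: level `j` becomes `(0, ρ² c, ρ³ c)`, and the second counter below
  -- receives `ρ² c`.
  obtain ⟨f2, hf2, f2le, f2P, f2Q, f2R⟩ := exists_move hf1.isFlow_right
    (fun m => m = 3 * j + 2 ∨ m = 3 * j) (fun m => m = 3 * j + 1 ∨ m + 2 = 3 * j) hb2
    (fun e => by linarith [hfM e, f1le e])
    (by
      rintro m hm (rfl | rfl)
      · rw [f12]; linarith
      · rw [f10])
    ⟨3 * j, by omega, Or.inr rfl, f10⟩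
  have f20 := f2P (3 * j) (by omega) (Or.inr rfl)
  have f22 := f2P (3 * j + 2) (by omega) (Or.inl rfl)
  have f21 := f2Q (3 * j + 1) (by omega) (by omega) (Or.inl rfl)
  rw [f10, sub_self] at f20
  rw [f11, zero_add] at f21
  rw [f12, e2] at f22
  have hle : ρ ^ 3 * c ≤ ρ ^ 2 * c := by
    have : 0 < ρ * (ρ ^ 3 * c) := mul_pos hρ0 hb3
    linarith
  -- Move 3 pushes `ρ³ c` and gives `(ρ³ c, ρ⁴ c, 0)`; the level below is left alone.
  obtain ⟨f3, hf3, f3le, f3P, f3Q, f3R⟩ := exists_move hf2.isFlow_right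
    (fun m => m = 3 * j + 1 ∨ m = 3 * j + 2) (fun m => m = 3 * j) hb3
    (fun e => by linarith [hfM e, f1le e, f2le e])
    (by
      rintro m hm (rfl | rfl)
      · rw [f21]; exact hle
      · rw [f22])
    ⟨3 * j + 2, by omega, Or.inr rfl, f22⟩
  have f31 := f3P (3 * j + 1) (by omega) (Or.inl rfl)
  have f32 := f3P (3 * j + 2) (by omega) (Or.inr rfl)
  have f30 := f3Q (3 * j) (by omega) (by omega) rfl
  rw [f20, zero_add] at f30
  rw [f21, e3] at f31
  rw [f22, sub_self] at f32
  have hγ : (1 + 1 + 1 : Ordinal.{0}) = 3 := by norm_num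
  refine ⟨f3, hγ ▸ (hf1.trans hf2).trans hf3, fun e => ?_, f30, f31, f32, fun m hm h => ?_,
    fun m hm => ?_⟩
  · linarith [f1le e, f2le e, f3le e]
  · rw [f3R m hm (by omega) (by omega), f2R m hm (by omega) (by omega),
      f1R m hm (by omega) (by omega)]
  · rw [f3R m (by omega) (by omega) (by omega)]
    by_cases h3 : m + 3 = 3 * j
    · rw [if_pos h3, f2R m (by omega) (by omega) (by omega),
        f1Q m (by omega) (by omega) (Or.inr h3), r3 m hm, zero_add]
    · rw [if_neg h3]
      by_cases h2 : m + 2 = 3 * j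
      · rw [if_pos h2, f2Q m (by omega) (by omega) (Or.inr h2),
          f1R m (by omega) (by omega) (by omega), r3 m hm]
        ring
      · rw [if_neg h2, f2R m (by omega) (by omega) (by omega),
          f1R m (by omega) (by omega) (by omega), r3 m hm]

/-- A round on level `j` shrinks its counters by `ρ ^ 3`; the level below is refilled and emptied
meanwhile. -/
theorem exists_round {ρ : ℝ} (hρ0 : 0 < ρ) (hρ : ρ ^ 2 = 1 - ρ) {j : ℕ}
    (hj : 3 * j + 3 ≤ n) (ih : ∀ i, j = i + 1 → CanEmpty n d M hn hM ρ i)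
    {f : Fin n × Fin 5 ⊕ Fin d → ℝ} {c : ℝ}
    (hf : (chain n d M hn hM).IsFlow f) (hc : 0 < c) (hr : IsReady ρ f j c)
    (hfM : ∀ e, f e + 2 * (j + 1) * c * (1 - ρ ^ 3) ≤ M) :
    ∃ γ g, (chain n d M hn hM).Reaches f γ g ∧ ω ^ (j : Ordinal.{0}) ≤ γ ∧
      IsReady ρ g j (ρ ^ 3 * c) ∧
      (∀ m < n, 3 * j + 3 ≤ m → counter g m = counter f m) ∧
      ∀ e, g e ≤ f e + 2 * (j + 1) * c * (1 - ρ ^ 3) := by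
  have hρ3 : ρ ^ 3 = 2 * ρ - 1 := by linear_combination (ρ - 1) * hρ
  -- A round raises an arc by at most `2 ρ c`, plus `2 j ρ c` for emptying the level below. This
  -- fits since `1 - ρ³ = 2 - 2ρ ≥ ρ`.
  have hK : 2 * ((j : ℝ) + 1) * (ρ * c) ≤ 2 * (j + 1) * c * (1 - ρ ^ 3) := by
    rw [hρ3, mul_assoc _ c]
    refine mul_le_mul_of_nonneg_left ?_ (by positivity)
    nlinarith
  have hb : 0 < ρ * c := mul_pos hρ0 hc
  have hjb : 0 ≤ (j : ℝ) * (ρ * c) := by positivity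
  obtain ⟨g, h1, hle, g0, g1, g2, hu, hl⟩ := exists_three_moves hρ0 hρ hj hf hc hr
    (fun e => by linarith [hfM e])
  rcases j with _ | j
  · refine ⟨3, g, h1, ?_, ⟨g0, g1, g2, fun m hm => by omega⟩, hu, fun e => ?_⟩
    · rw [Nat.cast_zero, Ordinal.opow_zero]
      exact_mod_cast (show 1 ≤ 3 by norm_num)
    · linarith [hle e]
  · push_cast at hfM hK hjb hle ⊢
    obtain ⟨γ, g', h2, hγ, hz, hu', hle'⟩ := ih j rfl g (ρ * c) h1.isFlow_right hb
      ⟨by simp [hl (3 * j) (by omega), show 3 * j + 3 = 3 * (j + 1) by ring],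
        by rw [hl _ (by omega), if_neg (by omega), if_pos (by omega)],
        by rw [hl _ (by omega), if_neg (by omega), if_neg (by omega)],
        fun m hm => by rw [hl _ (by omega), if_neg (by omega), if_neg (by omega)]⟩
      (fun e => by linarith [hle e, hfM e])
    refine ⟨_, g', h1.trans h2, (by exact_mod_cast hγ : _ ≤ γ).trans le_add_self,
      ⟨?_, ?_, ?_, fun m hm => hz m (by omega)⟩, fun m hm h => ?_, fun e => ?_⟩
    · rw [hu' _ (by omega) (by omega), g0]
    · rw [hu' _ (by omega) (by omega), g1]
    · rw [hu' _ (by omega) (by omega), g2]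
    · rw [hu' _ hm (by omega), hu _ hm h]
    · linarith [hle e, hle' e]

theorem tendsto_counter {F : ℕ → Fin n × Fin 5 ⊕ Fin d → ℝ} {g : Fin n × Fin 5 ⊕ Fin d → ℝ}
    (h : ∀ e, Tendsto (fun i => F i e) atTop (𝓝 (g e))) (m : ℕ) :
    Tendsto (fun i => counter (F i) m) atTop (𝓝 (counter g m)) := by
  unfold counter
  split_ifs
  · exact h _
  · exact tendsto_const_nhds

/-- Infinitely many rounds, each of length at least `ω ^ j`, scale the counters by `ρ³` every time,
so they vanish in the limit. The increases allowed per round, proportional to `(ρ³) ^ i * (1 - ρ³)`,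
telescope to at most `2 (j + 1) c`. -/
theorem canEmpty_of_forall {ρ : ℝ} (hρ0 : 0 < ρ) (hρ : ρ ^ 2 = 1 - ρ) {j : ℕ}
    (hj : 3 * j + 3 ≤ n) (ih : ∀ i, j = i + 1 → CanEmpty n d M hn hM ρ i) :
    CanEmpty n d M hn hM ρ j := by
  intro f c hf hc hr hfM
  have hρ3 : 0 < ρ ^ 3 := pow_pos hρ0 3
  have hρ3' : ρ ^ 3 < 1 := pow_lt_one₀ hρ0.le (by nlinarith) (by norm_num)
  have hK : 0 ≤ 2 * ((j : ℝ) + 1) * c := by positivity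
  obtain ⟨γ, g, hg, hγ, F, hF, ht⟩ := Reaches.exists_limit_of_invariant
    (N := chain n d M hn hM) (f := f) (δ := ω ^ (j : Ordinal.{0}))
    (Inv := fun i f' => (chain n d M hn hM).IsFlow f' ∧ IsReady ρ f' j ((ρ ^ 3) ^ i * c) ∧
      (∀ m < n, 3 * j + 3 ≤ m → counter f' m = counter f m) ∧
      ∀ e, f' e ≤ f e + 2 * (j + 1) * c * (1 - (ρ ^ 3) ^ i))
    (Ordinal.opow_pos _ Ordinal.omega0_pos)
    ⟨hf, by simpa using hr, fun _ _ _ => rfl, fun e => by simp⟩ (by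
      rintro i f' ⟨h1, h2, h3, h4⟩
      have hpos : 0 ≤ 2 * ((j : ℝ) + 1) * c * ((ρ ^ 3) ^ i * ρ ^ 3) := by positivity
      obtain ⟨γ, g, hg, hγ, hr', hu, hle⟩ := exists_round hρ0 hρ hj ih h1
        (c := (ρ ^ 3) ^ i * c) (by positivity) h2 (fun e => by nlinarith [h4 e, hfM e])
      refine ⟨γ, g, hg, hγ, hg.isFlow_right, ?_, fun m hm h => (hu m hm h).trans (h3 m hm h),
        fun e => ?_⟩
      · rwa [pow_succ', mul_assoc]
      · rw [pow_succ]
        nlinarith [h4 e, hle e])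
  have hpow : Tendsto (fun i => (ρ ^ 3) ^ i * c) atTop (𝓝 0) := by
    simpa using (tendsto_pow_atTop_nhds_zero_of_lt_one hρ3.le hρ3').mul_const c
  refine ⟨γ, g, hg, ?_, fun m hm => ?_, fun m hm h => ?_, fun e => ?_⟩
  · rwa [Nat.cast_add_one, Ordinal.opow_add_one]
  · refine tendsto_nhds_unique (tendsto_counter ht m) ?_
    rcases (by omega : m = 3 * j ∨ m = 3 * j + 1 ∨ m = 3 * j + 2 ∨ m < 3 * j) with
      rfl | rfl | rfl | h
    · exact hpow.congr fun i => ((hF i).2.1.1).symm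
    · simpa using (hpow.const_mul ρ).congr fun i => ((hF i).2.1.2.1).symm
    · exact tendsto_const_nhds.congr fun i => ((hF i).2.1.2.2.1).symm
    · exact tendsto_const_nhds.congr fun i => ((hF i).2.1.2.2.2 m h).symm
  · exact tendsto_nhds_unique (tendsto_counter ht m)
      (tendsto_const_nhds.congr fun i => ((hF i).2.2.1 m hm h).symm)
  · refine le_of_tendsto' (ht e) fun i => ((hF i).2.2.2 e).trans ?_
    have : 0 ≤ 2 * ((j : ℝ) + 1) * c * (ρ ^ 3) ^ i := by positivity
    linarith

theorem canEmpty {ρ : ℝ} (hρ0 : 0 < ρ) (hρ : ρ ^ 2 = 1 - ρ) (j : ℕ)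
    (hj : 3 * j + 3 ≤ n) : CanEmpty n d M hn hM ρ j := by
  induction j with
  | zero => exact canEmpty_of_forall hρ0 hρ hj fun i h => by omega
  | succ j ih =>
    refine canEmpty_of_forall hρ0 hρ hj fun i h => ?_
    obtain rfl : j = i := by omega
    exact ih (by omega)

end chain

end Network

/-! ### Assembling the bounds -/

theorem exists_sq_eq_one_sub : ∃ ρ : ℝ, 0 < ρ ∧ ρ ^ 2 = 1 - ρ := by
  have h5 : √(5 : ℝ) ^ 2 = 5 := Real.sq_sqrt (by norm_num)
  have h0 : 0 ≤ √(5 : ℝ) := Real.sqrt_nonneg 5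
  exact ⟨(√5 - 1) / 2, by nlinarith, by linear_combination h5 / 4⟩

/-- A network with `15 * k + d` arcs on which the algorithm can take `ω ^ k` steps. -/
theorem exists_run_chain (k d : ℕ) (hk : 0 < k) : ∃ (V E : Type) (_ : Fintype V) (_ : Fintype E)
    (N : Network V E) (r : N.Run), N.IsSimple ∧ Fintype.card E = 15 * k + d ∧
      r.Terminates ∧ ω ^ (k : Ordinal.{0}) ≤ r.runTime := by
  obtain ⟨j, rfl⟩ := Nat.exists_eq_add_one.2 hk
  obtain ⟨ρ, hρ0, hρ⟩ := exists_sq_eq_one_sub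
  have hn : 0 < 3 * (j + 1) := by omega
  -- The initial flow is at most `1` on each arc, and emptying level `j` with `c = 1` adds at most
  -- `2 (j + 1)`; with this capacity forward steps never limit a move.
  have hM : (1 : ℝ) ≤ 1 + 2 * (j + 1) := by
    have : (0 : ℝ) ≤ j := Nat.cast_nonneg j
    linarith
  let x : ℕ → ℝ := fun m => if m = 3 * j then 1 else if m = 3 * j + 1 then ρ else 0
  have hx : ∀ m, 0 ≤ x m ∧ x m ≤ 1 := fun m => by
    simp only [x]
    split_ifs <;> constructor <;> nlinarith
  obtain ⟨γ, g, h, hγ, -⟩ := Network.chain.canEmpty (n := 3 * (j + 1)) (d := d) (hn := hn)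
    (hM := zero_le_one.trans hM) hρ0 hρ j le_rfl (Network.chain.start _ d x) 1
    (Network.chain.isFlow_start hn hM hx) one_pos
    ⟨by rw [Network.chain.counter_start x (by omega)]; simp [x],
      by rw [Network.chain.counter_start x (by omega)]; simp [x],
      by rw [Network.chain.counter_start x (by omega)]; simp [x],
      fun m hm => by
        rw [Network.chain.counter_start x (by omega)]
        simp only [x]
        rw [if_neg (by omega), if_neg (by omega)]⟩
    (fun e => by linarith [(Network.chain.start_mem_Icc (n := 3 * (j + 1)) (d := d) hx e).2])
  obtain ⟨r, hr, hrγ⟩ := h.exists_run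
  refine ⟨_, _, inferInstance, inferInstance, _, r, Network.chain.isSimple _ _ _, ?_, hr,
    hγ.trans hrγ⟩
  simp
  ring

/-- A network with `l + 1` arcs on which the algorithm takes at least one step. -/
theorem exists_run_star (l : ℕ) : ∃ (V E : Type) (_ : Fintype V) (_ : Fintype E)
    (N : Network V E) (r : N.Run), N.IsSimple ∧ Fintype.card E = l + 1 ∧
      r.Terminates ∧ 1 ≤ r.runTime := by
  let N : Network (Fin (l + 2)) (Fin (l + 1)) :=
    { src := fun _ => 0
      tgt := Fin.succ
      cap := fun _ => 1
      cap_nonneg := fun _ => zero_le_one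
      s := 0
      t := 1
      s_ne_t := zero_ne_one }
  have hf : N.IsFlow 0 := ⟨fun e => ⟨le_rfl, zero_le_one⟩, fun u _ _ => by simp⟩
  have hp : N.IsAugmenting 0 [(0, true)] := by
    refine ⟨⟨rfl, ?_⟩, ?_, ?_⟩
    · simp [N, Network.IsWalk, Network.stepTgt]
    · simp [N, Network.stepTgt]
    · simp [N, Network.residualCap]
  obtain ⟨r, hr, h1⟩ := (Network.Reaches.of_isAugmenting hf hp).exists_run
  refine ⟨_, _, inferInstance, inferInstance, N, r, ⟨fun e => ?_, fun e e' _ h => ?_⟩, ?_, hr, h1⟩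
  · exact (Fin.succ_ne_zero e).symm
  · exact Fin.succ_injective _ h
  · simp

theorem exists_run_omega0_opow (l : ℕ) (hl : 1 ≤ l) : ∃ (V E : Type) (_ : Fintype V)
    (_ : Fintype E) (N : Network V E) (r : N.Run), N.IsSimple ∧ Fintype.card E = l ∧
      r.Terminates ∧ ω ^ ((l / 25 : ℕ) : Ordinal.{0}) ≤ r.runTime := by
  rcases Nat.eq_zero_or_pos (l / 25) with h | h
  · obtain ⟨m, rfl⟩ := Nat.exists_eq_add_one.2 hl
    simpa [h] using exists_run_star m
  -- The arcs left over beyond `15 * (l / 25)` become dead ends at the source.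
  · have := exists_run_chain (l / 25) (l - 15 * (l / 25)) h
    rwa [Nat.add_sub_cancel' (by omega)] at this

theorem runTime_mem_upperBounds (m : ℕ) :
    ω ^ (m : Ordinal.{0}) ∈ upperBounds (runTimes m) := by
  rintro _ ⟨V, E, _, _, N, r, rfl, rfl⟩
  exact r.runTime_le

theorem isTheta_div (c : ℕ) (hc : 0 < c) :
    (fun m : ℕ => ((m / c : ℕ) : ℝ)) =Θ[atTop] fun m : ℕ => (m : ℝ) := by
  constructor
  · refine IsBigO.of_bound 1 (Eventually.of_forall fun m => ?_)
    simpa using Nat.div_le_self m c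
  · refine IsBigO.of_bound (2 * c) (eventually_atTop.2 ⟨c, fun m hm => ?_⟩)
    simp only [Real.norm_natCast]
    have h1 := Nat.div_add_mod m c
    have h2 := Nat.mod_lt m hc
    have h3 : 1 ≤ m / c := (Nat.one_le_div_iff hc).2 hm
    -- The remainder is less than `c`, which is at most `c * (m / c)` once `m ≥ c`.
    have h4 : m ≤ 2 * c * (m / c) := by nlinarith
    exact_mod_cast h4

end FordFulkerson

theorem mainTheorem1 :
    -- every run is well defined, and terminates after at most `ω ^ |E|` steps
    (∀ (V E : Type*) [Fintype V] [Fintype E] (N : FordFulkerson.Network V E) (r : N.Run),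
      (∀ α, N.IsFlow (r.flow α)) ∧
      (∀ α, Order.IsSuccLimit α → ∀ e,
        Summable (fun β : Set.Iio α => r.increment β.1 (r.flow β.1) e) ∧
        Tendsto (fun β => r.flow β e) (𝓝[<] α) (𝓝 (r.flow α e))) ∧
      r.Terminates ∧ r.runTime ≤ ω ^ (Fintype.card E : Ordinal.{0})) ∧
    -- for every `l ≥ 1` there are a network with `l` arcs and a run of length at least
    -- `ω ^ ⌊l / 25⌋`
    (∀ l : ℕ, 1 ≤ l → ∃ (V E : Type) (_ : Fintype V) (_ : Fintype E)
      (N : FordFulkerson.Network V E) (r : N.Run), N.IsSimple ∧ Fintype.card E = l ∧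
        r.Terminates ∧ ω ^ ((l / 25 : ℕ) : Ordinal.{0}) ≤ r.runTime) ∧
    -- the worst-case running time on networks with `m` arcs is `ω ^ Θ(m)`
    (∃ g h : ℕ → ℕ,
      (fun m => (g m : ℝ)) =Θ[atTop] (fun m => (m : ℝ)) ∧
      (fun m => (h m : ℝ)) =Θ[atTop] (fun m => (m : ℝ)) ∧
      ∀ m : ℕ, 1 ≤ m → BddAbove (FordFulkerson.runTimes m) ∧
        ω ^ (g m : Ordinal.{0}) ≤ FordFulkerson.worstCase m ∧
        FordFulkerson.worstCase m ≤ ω ^ (h m : Ordinal.{0})) := by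
  refine ⟨fun V E _ _ N r => ⟨r.isFlow_flow, fun α hα e =>
    ⟨r.summable_increment hα e, r.tendsto_flow hα e⟩, r.terminates, r.runTime_le⟩,
    FordFulkerson.exists_run_omega0_opow, fun m => m / 25, fun m => m, FordFulkerson.isTheta_div 25 (by norm_num),
    isTheta_rfl, fun m hm => ?_⟩
  have hb : BddAbove (FordFulkerson.runTimes m) := ⟨_, FordFulkerson.runTime_mem_upperBounds m⟩
  obtain ⟨V, E, hV, hE, N, r, -, hc, -, hr⟩ := FordFulkerson.exists_run_omega0_opow m hm
  have hmem : r.runTime ∈ FordFulkerson.runTimes m := ⟨V, E, hV, hE, N, r, hc, rfl⟩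
  exact ⟨hb, hr.trans (le_csSup hb hmem), csSup_le ⟨_, hmem⟩ (FordFulkerson.runTime_mem_upperBounds m)⟩
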